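/- Let $(\mathcal X,d,\mu)$ be a compact homogeneous space: up to a measure-preserving isometry, $\mathcal X=G/K$ with $G$ a compact topological group, $K$ a closed subgroup, $d$ a $G$-invariant distance inducing the quotient topology, and $\mu$ the push-forward of the normalised Haar measure of $G$. Let $p\ge 1$ and let $\varphi:\mathbb R^{\binom p2}\to\mathbb R$ be continuous. For a probability measure $\rho$ on $\mathcal X$ put $\Phi(\rho)=\int_{\mathcal X^p}\varphi\big((d(x_i,x_j))_{1\le i<j\le p}\big)\,\rho^{\otimes p}(dx)$. Let $X_1,X_2,\dots$ be independent random points with law $\mu$, and write $$\Phi(\mathscr X)=\Phi(\mu),\qquad \Phi(\mathscr X_n)=\Phi\Big(\tfrac1n\sum_{i=1}^n\delta_{X_i}\Big),\qquad S_n=n^p\,\Phi(\mathscr X_n)=\sum_{\bar\imath\in\{1,\dots,n\}^p}\varphi(d(X_{\bar\imath})),$$ where $d(X_{\bar\imath})=(d(X_{\bar\imath_a},X_{\bar\imath_b}))_{1\le a<b\le p}$. Joint cumulants are $\kappa(Z_1,\dots,Z_r)=\sum_{\pi}(-1)^{\ell(\pi)-1}(\ell(\pi)-1)!\prod_{C\in\pi}\mathbb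 E\big[\prod_{i\in C}Z_i\big]$, the sum being over the set partitions $\pi$ of $\{1,\dots,r\}$, with $\ell(\pi)$ the number of parts; $\kappa^{(r)}(Z)=\kappa(Z,\dots,Z)$. For a set partition $\pi$ of $\{1,\dots,pr\}$ let $\kappa(\pi,\varphi)=\kappa\big(\varphi(d(X_{\bar\imath^1})),\dots,\varphi(d(X_{\bar\imath^r}))\big)$, where $(\bar\imath^1,\dots,\bar\imath^r)$ is any list of $pr$ indices (the $k$-th tuple occupying the positions $(k-1)p+1,\dots,kp$) in which two positions carry the same index if and only if they lie in the same part of $\pi$. Call $\pi$ homogeneously vanishing if for some $k\in\{1,\dots,r\}$ at least $p-1$ of the integers $(k-1)p+1,\dots,kp$ are singletons of $\pi$. For $r\ge1$ let $$K_r=\sum_{\substack{\pi\text{ set partition of }\{1,\dots,pr\}\\ \ell(\pi)=(p-1)r\\ \pi\text{ not homogeneously vanishing}}}\kappa(\pi,\varphi).$$ Then the limit $\sigma^2_{\mathrm{hom}}=\lim_{n\to\infty}\mathrm{var}(S_n)/n^{2(p-1)}$ exists, and it equals $$\sum_{1\le k_1<k_2\le p}\ \sum_{\substack{1\le l_1,l_2\le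 p\\ l_1\ne l_2}}\kappa(\pi_{k_1,l_1,k_2,l_2},\varphi),$$ where $\pi_{k_1,l_1,k_2,l_2}$ is the set partition of $\{1,\dots,2p\}$ with parts $\{k_1,l_1+p\}$, $\{k_2,l_2+p\}$ and singletons. Suppose that $\sigma^2_{\mathrm{hom}}>0$, and let $\sigma_{\mathrm{hom}}>0$ be its square root. Then: 1. The random variables $$Y_n=\frac{\Phi(\mathscr X_n)-\Phi(\mathscr X)}{\sqrt{\mathrm{var}(\Phi(\mathscr X_n))}}$$ converge in distribution to a real random variable $Y$ whose moment-generating function is finite in a neighbourhood of $0$ and whose cumulants are $$\kappa^{(r)}(Y)=\frac{K_r}{\sigma_{\mathrm{hom}}^{\,r}}\quad(r\ge2),\qquad \kappa^{(1)}(Y)=\frac{K_1-\binom p2\,\Phi(\mathscr X)}{\sigma_{\mathrm{hom}}}.$$ The law of $Y$ is determined by its cumulants, and equivalently by its moments: it is the only probability measure on $\mathbb R$ with finite moments of all orders that has these cumulants (respectively, moments). 2. $\sqrt{\mathrm{var}(\Phi(\mathscr X_n))}$ is of order $n^{-1}$ (bounded above and below by positive multiples of $n^{-1}$ for $n$ large),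 and there is a real polynomial $Q$ without constant term and without term of degree $1$, with coefficient of degree $2$ equal to $\sigma^2_{\mathrm{hom}}$, such that $\mathrm{var}(\Phi(\mathscr X_n))=Q(n^{-1})$ for all $n\ge1$. -/

import Mathlib

open MeasureTheory ProbabilityTheory Filter Topology Asymptotics
open scoped ENNReal

noncomputable section

namespace MMSpace

universe u v

/-- `(X, d, μ)` is a compact homogeneous space: up to a measure-preserving isometry it is `G ⧸ K`
with `G` a compact (Hausdorff) topological group, `K` a closed subgroup, a `G`-invariant distance
inducing the quotient topology, and the push-forward of the normalised Haar measure of `G`.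
(Completeness and separability of `X`, and the fact that `μ` has full support, follow.) -/
def IsCompactHomogeneous (X : Type u) [MetricSpace X] [MeasurableSpace X] (μ : Measure X) : Prop :=
  ∃ (G : Type v) (_ : Group G) (_ : TopologicalSpace G) (_ : IsTopologicalGroup G)
    (_ : CompactSpace G) (_ : T2Space G) (_ : MeasurableSpace G) (_ : BorelSpace G)
    (K : Subgroup G) (η : Measure G) (e : (G ⧸ K) ≃ₜ X),
    IsClosed (K : Set G) ∧ η.IsHaarMeasure ∧ IsProbabilityMeasure η ∧
    (∀ (g : G) (a b : G ⧸ K), dist (e (g • a)) (e (g • b)) = dist (e a) (e b)) ∧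
    μ = η.map (fun g : G => e (g : G ⧸ K))

/-- The pairs `i < j` in `{1, …, p}`, so that `Pairs p → ℝ` is `ℝ^(p choose 2)`. -/
abbrev Pairs (p : ℕ) : Type := {q : Fin p × Fin p // q.1 < q.2}

variable {X : Type u} [MetricSpace X]

/-- The vector of distances `(d(x_i, x_j))_{i < j}`. -/
def distVec {p : ℕ} (x : Fin p → X) : Pairs p → ℝ := fun q => dist (x q.1.1) (x q.1.2)

/-- The polynomial observable `Φ = Φ^{p,φ}` evaluated at the mm-space `(X, d, μ)`. -/
def polyObs [MeasurableSpace X] {p : ℕ} (φ : C(Pairs p → ℝ, ℝ)) (μ : Measure X) : ℝ :=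
  ∫ x : Fin p → X, φ (distVec x) ∂(Measure.pi fun _ : Fin p => μ)

/-- The empirical measure of the first `n` points of a sequence; `(X, d, empMeasure x n)` is the
sample model of order `n`. -/
def empMeasure [MeasurableSpace X] (x : ℕ → X) (n : ℕ) : Measure X :=
  (n : ℝ≥0∞)⁻¹ • ∑ i ∈ Finset.range n, Measure.dirac (x i)

/-- `S_n(φ, x) = ∑_{i ∈ [n]^p} φ(d(x_i))`. -/
def sampleSum {p : ℕ} (φ : C(Pairs p → ℝ, ℝ)) (x : ℕ → X) (n : ℕ) : ℝ :=
  ∑ I : Fin p → Fin n, φ (distVec fun l => x (I l))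

/-- The joint cumulant `κ(Z_1, …, Z_r)`, as the Möbius sum over set partitions of `{1, …, r}`
of products of joint moments (used for `r ≥ 1` and variables having all moments). -/
def jointCumulant {Ω : Type*} [MeasurableSpace Ω] (P : Measure Ω) {r : ℕ}
    (Z : Fin r → Ω → ℝ) : ℝ :=
  ∑ π : Finpartition (Finset.univ : Finset (Fin r)),
    (-1 : ℝ) ^ (π.parts.card - 1) * ((π.parts.card - 1).factorial : ℝ) *
      ∏ C ∈ π.parts, ∫ ω, ∏ i ∈ C, Z i ω ∂P

/-- The `r`-th cumulant of (a random variable with) the law `ν` on `ℝ`. -/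
def cumulant (ν : Measure ℝ) (r : ℕ) : ℝ := jointCumulant ν (fun _ : Fin r => (id : ℝ → ℝ))

/-- Set partitions of `{1, …, pr}`, where `(k - 1) p + l` is written as the pair `(k, l)`. -/
abbrev SetPart (r p : ℕ) : Type := Finpartition (Finset.univ : Finset (Fin r × Fin p))

open Classical in
/-- The set partition `Sp(I)` given by the level sets of a family of indices `I`. -/
def Sp {ι : Type*} {r p : ℕ} (I : Fin r × Fin p → ι) : SetPart r p :=
  Finpartition.ofSetoid (Setoid.ker I)

/-- The tautological family of indices `I` with `Sp(I) = π`: each element is labelled by the part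
containing it. -/
def partLabel {r p : ℕ} (π : SetPart r p) (q : Fin r × Fin p) : {C // C ∈ π.parts} :=
  ⟨π.part q, π.part_mem.2 (Finset.mem_univ q)⟩

/-- `κ(π, φ) = κ(φ(d(X_{i^1})), …, φ(d(X_{i^r})))`, where `I = (i^1, …, i^r)` is a family of
indices with `Sp(I) = π` and the points `X_i` are independent with law `μ`. The indices are taken
here to be the parts of `π`. -/
def kappa [MeasurableSpace X] (μ : Measure X) {r p : ℕ} (φ : C(Pairs p → ℝ, ℝ))
    (π : SetPart r p) : ℝ :=
  jointCumulant (Measure.pi fun _ : {C // C ∈ π.parts} => μ)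
    (fun (k : Fin r) (x : {C // C ∈ π.parts} → X) =>
      φ (distVec fun l => x (partLabel π (k, l))))

/-- `π` is homogeneously vanishing: some block `{(k, 1), …, (k, p)}` contains (at least) `p - 1`
singletons of `π`. -/
def HomVanishing {r p : ℕ} (π : SetPart r p) : Prop :=
  ∃ k : Fin r, p - 1 ≤ (Finset.univ.filter fun l : Fin p => {(k, l)} ∈ π.parts).card

/-- The set partition of two rows of `p` points whose parts are `{k₁, l₁}`, `{k₂, l₂}` (the `k`'s in
the first row, the `l`'s in the second one) and singletons. -/
def doublePair {p : ℕ} (k₁ l₁ k₂ l₂ : Fin p) : SetPart 2 p :=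
  Sp fun q => if q = (1, l₁) then (0, k₁) else if q = (1, l₂) then (0, k₂) else q

/-- The combinatorial expansion of `σ²_hom(φ, X)`. -/
def sigmaHomSq [MeasurableSpace X] (μ : Measure X) {p : ℕ} (φ : C(Pairs p → ℝ, ℝ)) : ℝ :=
  ∑ k₁ : Fin p, ∑ k₂ : Fin p, ∑ l₁ : Fin p, ∑ l₂ : Fin p,
    if k₁ < k₂ ∧ l₁ ≠ l₂ then kappa μ φ (doublePair k₁ l₁ k₂ l₂) else 0

open Classical in
/-- The sum of the `κ(π, φ)` over the set partitions `π` of `{1, …, pr}` with `(p - 1) r` parts that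
are not homogeneously vanishing. -/
def kappaSum [MeasurableSpace X] (μ : Measure X) {p : ℕ} (φ : C(Pairs p → ℝ, ℝ)) (r : ℕ) : ℝ :=
  ∑ π : SetPart r p,
    if π.parts.card = (p - 1) * r ∧ ¬ HomVanishing π then kappa μ φ π else 0

/-- `Y_n = (Φ(X_n) - Φ(X)) / √var(Φ(X_n))`, where `X_n` is the sample model of order `n` built from
the random points `ξ 0, …, ξ (n - 1)`. -/
def fluct [MeasurableSpace X] (μ : Measure X) {p : ℕ} (φ : C(Pairs p → ℝ, ℝ))
    {Ω : Type*} [MeasurableSpace Ω] (P : Measure Ω) (ξ : ℕ → Ω → X) (n : ℕ) (ω : Ω) : ℝ :=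
  (polyObs φ (empMeasure (fun i => ξ i ω) n) - polyObs φ μ) /
    √(variance (fun ω' => polyObs φ (empMeasure (fun i => ξ i ω') n)) P)

end MMSpace

end

/-! Replacing `φ` by `φ - Φ(μ)` shifts `S_n` by the constant `n^p Φ(μ)`, so one may work with a
centred observable: cumulants of order at least two do not change, and the first one is corrected
separately (`kappaSum_centred_one`). A moment or a cumulant of `S_n` expands over families of `pr`
indices. Since the points are i.i.d., a term depends only on the partition `π` of positions into
equal indices, and `n(n-1)⋯(n-ℓ(π)+1)` families share a given `π` (`integral_sampleSum_pow`,
`jointCumulant_sampleSum`).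

Homogeneity lowers the order of magnitude. Suppose that all points of a row but one occur nowhere
else. Integrating them out leaves a function of a single point, which is constant because
measure-preserving isometries act transitively. The row is then uncorrelated with the other rows
(`integral_mul_of_free_row`), and the coefficient of a homogeneously vanishing `π` is zero. Any
other `π` has at least two non-singletons in each row, hence at most `(p-1)r` parts. The extremal
ones consist of singletons and exactly `r` pairs, with two paired positions in each row
(`extremal_structure`). Thus the moments of the centred `S_n / n^(p-1)` converge to finite sums over
extremal partitions.

There are at most `c^r r!` extremal partitions (`card_extremal_le`, `choose_choose_le`), so the
limit moments grow at most like `D^r r!`. This gives exponential moments and determinacy, and the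
method of moments applies (`exists_tendsto_of_moments_tendsto`). The cumulants of the limit follow
by continuity of the moment-cumulant formula, which is also invertible.

For `r = 2`, an extremal partition contributes only if it links the two rows, and it is then a
double pair (`kappaSum_two_eq_sigmaHomSq`). The exact expansion of the variance in falling
factorials gives the polynomial in `n⁻¹`. -/

set_option linter.unusedSectionVars false

noncomputable section

namespace MMSpace

/-! ### Index families and their level-set partitions -/

section Partitions

variable {α β : Type*} [Fintype α] [DecidableEq α]

open Classical in
/-- The partition of a finite type into the level sets of a function. -/
def kerPart (f : α → β) : Finpartition (Finset.univ : Finset α) :=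
  Finpartition.ofSetoid (Setoid.ker f)

/-- Each element is labelled by the part containing it. -/
def label (π : Finpartition (Finset.univ : Finset α)) (a : α) : {C // C ∈ π.parts} :=
  ⟨π.part a, π.part_mem.2 (Finset.mem_univ a)⟩

lemma mem_part_kerPart {f : α → β} {a b : α} : b ∈ (kerPart f).part a ↔ f a = f b := by
  classical
  unfold kerPart
  rw [Finpartition.mem_part_ofSetoid_iff_rel]
  rfl

lemma label_eq_label_iff {π : Finpartition (Finset.univ : Finset α)} {a b : α} :
    label π a = label π b ↔ b ∈ π.part a := by
  rw [label, label, Subtype.mk.injEq, eq_comm,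
    Finpartition.mem_part_iff_part_eq_part _ (Finset.mem_univ _) (Finset.mem_univ _)]

lemma label_surjective (π : Finpartition (Finset.univ : Finset α)) :
    Function.Surjective (label π) := by
  rintro ⟨C, hC⟩
  obtain ⟨a, ha⟩ := π.nonempty_of_mem_parts hC
  exact ⟨a, Subtype.ext (π.part_eq_of_mem hC ha)⟩

lemma parts_eq_image_part (π : Finpartition (Finset.univ : Finset α)) :
    π.parts = Finset.univ.image π.part := by
  ext C
  simp only [Finset.mem_image, Finset.mem_univ, true_and]
  constructor
  · intro hC
    obtain ⟨a, ha⟩ := label_surjective π ⟨C, hC⟩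
    exact ⟨a, congrArg Subtype.val ha⟩
  · rintro ⟨a, rfl⟩
    exact π.part_mem.2 (Finset.mem_univ a)

lemma finpartition_ext_part {π σ : Finpartition (Finset.univ : Finset α)}
    (h : ∀ a b, b ∈ π.part a ↔ b ∈ σ.part a) : π = σ := by
  have : π.part = σ.part := by
    funext a
    ext b
    exact h a b
  ext1
  rw [parts_eq_image_part, parts_eq_image_part, this]

lemma kerPart_eq_iff {f : α → β} {π : Finpartition (Finset.univ : Finset α)} :
    kerPart f = π ↔ ∀ a b, f a = f b ↔ b ∈ π.part a := by
  constructor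
  · rintro rfl a b
    exact mem_part_kerPart.symm
  · intro h
    exact finpartition_ext_part fun a b => mem_part_kerPart.trans (h a b)

lemma kerPart_embedding_comp_label (π : Finpartition (Finset.univ : Finset α))
    (j : {C // C ∈ π.parts} ↪ β) : kerPart (j ∘ label π) = π :=
  kerPart_eq_iff.2 fun _ _ => j.injective.eq_iff.trans label_eq_label_iff

lemma exists_embedding_of_kerPart (f : α → β) :
    ∃ j : {C // C ∈ (kerPart f).parts} ↪ β, f = j ∘ label (kerPart f) := by
  have hne : ∀ C : {C // C ∈ (kerPart f).parts}, ∃ a, label (kerPart f) a = C :=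
    label_surjective _
  choose s hs using hne
  refine ⟨⟨fun C => f (s C), fun C D h => ?_⟩, ?_⟩
  · rw [← hs C, ← hs D, label_eq_label_iff, mem_part_kerPart]
    exact h
  · funext a
    have := hs (label (kerPart f) a)
    rw [label_eq_label_iff, mem_part_kerPart] at this
    exact this.symm

-- Functions with level-set partition `π` are the injective labellings of the parts of `π`, hence
-- the falling factorial.
open Classical in
lemma card_filter_kerPart_eq (n : ℕ) (π : Finpartition (Finset.univ : Finset α)) :
    (Finset.univ.filter fun f : α → Fin n => kerPart f = π).card
      = n.descFactorial π.parts.card := by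
  have h1 : Fintype.card ({C // C ∈ π.parts} ↪ Fin n) = n.descFactorial π.parts.card := by
    rw [Fintype.card_embedding_eq, Fintype.card_fin, Fintype.card_coe]
  rw [← h1, ← Finset.card_univ]
  symm
  refine Finset.card_bij (fun (j : {C // C ∈ π.parts} ↪ Fin n) _ => j ∘ label π) ?_ ?_ ?_
  · intro j _
    simp [kerPart_embedding_comp_label]
  · intro j _ j' _ h
    ext C : 1
    obtain ⟨a, rfl⟩ := label_surjective π C
    exact congrFun h a
  · intro f hf
    obtain rfl := (Finset.mem_filter.1 hf).2
    obtain ⟨j, hj⟩ := exists_embedding_of_kerPart f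
    exact ⟨j, Finset.mem_univ _, hj.symm⟩

/-- Summation over index families, organised by the partition into level sets. -/
lemma sum_comp_kerPart (n : ℕ) (F : Finpartition (Finset.univ : Finset α) → ℝ) :
    ∑ f : α → Fin n, F (kerPart f) = ∑ π, (n.descFactorial π.parts.card : ℝ) * F π := by
  classical
  rw [← Finset.sum_fiberwise Finset.univ (fun f : α → Fin n => kerPart f)]
  refine Finset.sum_congr rfl fun π _ => ?_
  rw [← card_filter_kerPart_eq, ← nsmul_eq_mul, ← Finset.sum_const]
  exact Finset.sum_congr rfl fun f hf => by rw [(Finset.mem_filter.1 hf).2]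

/-- The parts of the level-set partition, seen as fibres. -/
lemma prod_parts_kerPart {n : ℕ} (w : Finset α → ℝ) (hw : w ∅ = 1) (f : α → Fin n) :
    ∏ C ∈ (kerPart f).parts, w C = ∏ j, w (Finset.univ.filter fun a => f a = j) := by
  classical
  have himg : (kerPart f).parts
      = (Finset.univ.image f).image fun j => Finset.univ.filter fun a => f a = j := by
    rw [parts_eq_image_part, Finset.image_image]
    refine Finset.image_congr fun a _ => ?_
    ext b
    simp [mem_part_kerPart, eq_comm]
  rw [himg, Finset.prod_image]
  -- A value that is not attained has an empty fibre and contributes `w ∅ = 1`.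
  · refine Finset.prod_subset (Finset.subset_univ _) fun j _ hj => ?_
    rw [Finset.filter_eq_empty_iff.2, hw]
    intro a _ ha
    exact hj (Finset.mem_image.2 ⟨a, Finset.mem_univ _, ha⟩)
  · intro i hi j hj hij
    obtain ⟨a, -, rfl⟩ := Finset.mem_image.1 hi
    have : a ∈ Finset.univ.filter fun b => f b = j := by
      simpa using Finset.ext_iff.1 hij a
    simpa using this

end Partitions

/-! ### Cumulants as linear coefficients of a polynomial -/

section MomentPolynomial

variable {α : Type*} [Fintype α] [DecidableEq α]

open Polynomial

/-- The polynomial whose value at `n` is `∑_f ∏_j w(f⁻¹(j))`, the sum being over the functions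
`f` from `α` to a set with `n` elements. Its linear coefficient is the cumulant attached to `w`. -/
def momentPoly (w : Finset α → ℝ) : ℝ[X] :=
  ∑ π : Finpartition (Finset.univ : Finset α),
    C (∏ c ∈ π.parts, w c) * descPochhammer ℝ π.parts.card

lemma eval_momentPoly (w : Finset α → ℝ) (hw : w ∅ = 1) (n : ℕ) :
    (momentPoly w).eval (n : ℝ)
      = ∑ f : α → Fin n, ∏ j, w (Finset.univ.filter fun a => f a = j) := by
  simp_rw [← prod_parts_kerPart w hw]
  rw [sum_comp_kerPart n fun π => ∏ c ∈ π.parts, w c, momentPoly, eval_finsetSum]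
  refine Finset.sum_congr rfl fun π _ => ?_
  rw [eval_mul, eval_C, descPochhammer_eval_eq_descFactorial, mul_comm]

lemma descPochhammer_coeff_zero {n : ℕ} (hn : n ≠ 0) : (descPochhammer ℝ n).coeff 0 = 0 := by
  rw [coeff_zero_eq_eval_zero, descPochhammer_ne_zero_eval_zero ℝ hn]

lemma descPochhammer_succ_coeff_one (n : ℕ) :
    (descPochhammer ℝ (n + 1)).coeff 1 = (-1) ^ n * (n.factorial : ℝ) := by
  induction n with
  | zero => simp
  | succ n ih =>
    rw [descPochhammer_succ_right, mul_sub, coeff_sub, coeff_mul_X,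
      descPochhammer_coeff_zero n.succ_ne_zero, ← C_eq_natCast, coeff_mul_C, ih,
      Nat.factorial_succ]
    push_cast
    ring

lemma card_parts_ne_zero [Nonempty α] (π : Finpartition (Finset.univ : Finset α)) :
    π.parts.card ≠ 0 := by
  rw [Finset.card_ne_zero]
  exact π.parts_nonempty (Finset.univ_nonempty (α := α)).ne_empty

/-- The Möbius weight `(-1)^(ℓ-1) (ℓ-1)!` is the linear coefficient of the falling factorial of
degree `ℓ`. Vanishing of a cumulant can thus be read off a polynomial identity, without manipulating
Möbius sums. -/
lemma momentPoly_coeff_one [Nonempty α] (w : Finset α → ℝ) :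
    (momentPoly w).coeff 1 = ∑ π : Finpartition (Finset.univ : Finset α),
      (-1 : ℝ) ^ (π.parts.card - 1) * ((π.parts.card - 1).factorial : ℝ) *
        ∏ c ∈ π.parts, w c := by
  rw [momentPoly, finsetSum_coeff]
  refine Finset.sum_congr rfl fun π _ => ?_
  obtain ⟨m, hm⟩ := Nat.exists_eq_succ_of_ne_zero (card_parts_ne_zero π)
  rw [coeff_C_mul, hm, Nat.succ_eq_add_one, descPochhammer_succ_coeff_one, Nat.add_sub_cancel]
  ring

lemma momentPoly_coeff_zero [Nonempty α] (w : Finset α → ℝ) : (momentPoly w).coeff 0 = 0 := by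
  rw [momentPoly, finsetSum_coeff]
  refine Finset.sum_eq_zero fun π _ => ?_
  rw [coeff_C_mul, descPochhammer_coeff_zero (card_parts_ne_zero π), mul_zero]

/-- If the variable of index `k` splits off all moments, the cumulant vanishes. -/
lemma momentPoly_coeff_one_eq_zero [Nontrivial α] (w : Finset α → ℝ) (hw : w ∅ = 1) (k : α) (a : ℝ)
    (h : ∀ c, k ∈ c → w c = a * w (c.erase k)) : (momentPoly w).coeff 1 = 0 := by
  obtain ⟨k', hk'⟩ := exists_ne k
  have : Nonempty {i // i ≠ k} := ⟨⟨k', hk'⟩⟩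
  let v : Finset {i // i ≠ k} → ℝ := fun c => w (c.map (Function.Embedding.subtype _))
  have hv : v ∅ = 1 := by simp [v, hw]
  -- It suffices to compare values at the integers `n`. The fibre containing `k` can be chosen in
  -- `n` ways without affecting the weight of the rest, whence the factor `X`; as `momentPoly v` has
  -- no constant term, the product has no linear term.
  have key : momentPoly w = C a * (X * momentPoly v) := by
    refine eq_of_infinite_eval_eq _ _ (Set.Infinite.mono ?_ (Set.infinite_range_of_injective
      (Nat.cast_injective (R := ℝ))))
    rintro _ ⟨n, rfl⟩
    simp only [Set.mem_ofPred_eq, eval_mul, eval_C, eval_X]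
    rw [eval_momentPoly w hw, eval_momentPoly v hv,
      ← (Equiv.funSplitAt k (Fin n)).symm.sum_comp, Fintype.sum_prod_type]
    have : ∀ (j₀ : Fin n) (g : {i // i ≠ k} → Fin n),
        ∏ j, w (Finset.univ.filter fun i => (Equiv.funSplitAt k (Fin n)).symm (j₀, g) i = j)
          = a * ∏ j, v (Finset.univ.filter fun i => g i = j) := by
      intro j₀ g
      set f := (Equiv.funSplitAt k (Fin n)).symm (j₀, g) with hf
      have hfk : f k = j₀ := by simp [hf]
      have hfi : ∀ i : {i // i ≠ k}, f i = g i := fun i => by simp [hf, i.2]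
      have hset : ∀ j, (Finset.univ.filter fun i => f i = j).erase k
          = (Finset.univ.filter fun i => g i = j).map (Function.Embedding.subtype _) := by
        intro j
        ext i
        simp only [Finset.mem_erase, Finset.mem_filter, Finset.mem_univ, true_and,
          Finset.mem_map, Function.Embedding.subtype_apply, Subtype.exists, exists_and_right,
          exists_eq_right]
        constructor
        · rintro ⟨h1, h2⟩
          exact ⟨h1, by rw [← hfi]; exact h2⟩
        · rintro ⟨h1, h2⟩
          exact ⟨h1, by rw [← h2, ← hfi]⟩
      rw [← Finset.mul_prod_erase _ _ (Finset.mem_univ j₀),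
        ← Finset.mul_prod_erase Finset.univ (fun j => v _) (Finset.mem_univ j₀),
        h _ (by simp [hfk]), hset, mul_assoc]
      congr 2
      refine Finset.prod_congr rfl fun j hj => ?_
      rw [← Finset.erase_eq_of_notMem (a := k) (s := Finset.univ.filter fun i => f i = j), hset]
      simp only [Finset.mem_filter, Finset.mem_univ, true_and, hfk]
      exact (Finset.ne_of_mem_erase hj).symm
    simp_rw [this, ← Finset.mul_sum]
    rw [Finset.sum_const, Finset.card_univ, Fintype.card_fin, nsmul_eq_mul]
  rw [key, coeff_C_mul, coeff_X_mul, momentPoly_coeff_zero, mul_zero]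

end MomentPolynomial

/-! ### Bounded measurable functions -/

section BoundedVariables

variable {Ω Λ : Type*} [MeasurableSpace Ω] [MeasurableSpace Λ]

/-- Bounded measurable real functions. -/
def BddMeas (Z : Ω → ℝ) : Prop := Measurable Z ∧ ∃ B, ∀ ω, |Z ω| ≤ B

lemma BddMeas.integrable {Z : Ω → ℝ} (hZ : BddMeas Z) (P : Measure Ω) [IsFiniteMeasure P] :
    Integrable Z P := by
  obtain ⟨hm, B, hB⟩ := hZ
  exact Integrable.of_bound hm.aestronglyMeasurable B (ae_of_all _ hB)

lemma bddMeas_const (c : ℝ) : BddMeas (fun _ : Ω => c) :=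
  ⟨measurable_const, |c|, fun _ => le_rfl⟩

lemma BddMeas.mul {Y Z : Ω → ℝ} (hY : BddMeas Y) (hZ : BddMeas Z) :
    BddMeas (fun ω => Y ω * Z ω) := by
  obtain ⟨hY, A, hA⟩ := hY
  obtain ⟨hZ, B, hB⟩ := hZ
  refine ⟨hY.mul hZ, A * B, fun ω => ?_⟩
  rw [abs_mul]
  exact mul_le_mul (hA ω) (hB ω) (abs_nonneg _) ((abs_nonneg _).trans (hA ω))

lemma BddMeas.add {Y Z : Ω → ℝ} (hY : BddMeas Y) (hZ : BddMeas Z) :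
    BddMeas (fun ω => Y ω + Z ω) := by
  obtain ⟨hY, A, hA⟩ := hY
  obtain ⟨hZ, B, hB⟩ := hZ
  exact ⟨hY.add hZ, A + B, fun ω => (abs_add_le _ _).trans (add_le_add (hA ω) (hB ω))⟩

lemma BddMeas.comp {Z : Ω → ℝ} (hZ : BddMeas Z) {f : Λ → Ω} (hf : Measurable f) :
    BddMeas (fun ω => Z (f ω)) :=
  ⟨hZ.1.comp hf, hZ.2.imp fun _ h ω => h (f ω)⟩

lemma bddMeas_prod {ι : Type*} {Z : ι → Ω → ℝ} (s : Finset ι) (h : ∀ i ∈ s, BddMeas (Z i)) :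
    BddMeas (fun ω => ∏ i ∈ s, Z i ω) := by
  classical
  induction s using Finset.induction_on with
  | empty => simpa using bddMeas_const 1
  | insert i s hi ih =>
    simp_rw [Finset.prod_insert hi]
    exact (h i (Finset.mem_insert_self _ _)).mul
      (ih fun j hj => h j (Finset.mem_insert_of_mem hj))

lemma bddMeas_sum {ι : Type*} {Z : ι → Ω → ℝ} (s : Finset ι) (h : ∀ i ∈ s, BddMeas (Z i)) :
    BddMeas (fun ω => ∑ i ∈ s, Z i ω) := by
  classical
  induction s using Finset.induction_on with
  | empty => simpa using bddMeas_const 0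
  | insert i s hi ih =>
    simp_rw [Finset.sum_insert hi]
    exact (h i (Finset.mem_insert_self _ _)).add
      (ih fun j hj => h j (Finset.mem_insert_of_mem hj))

lemma BddMeas.pow {Z : Ω → ℝ} (hZ : BddMeas Z) (k : ℕ) : BddMeas (fun ω => Z ω ^ k) := by
  have := bddMeas_prod (Finset.range k) (fun _ _ => hZ)
  simpa using this

end BoundedVariables

/-! ### Multilinearity, shift invariance and low orders of joint cumulants -/

section JointCumulants

variable {Ω : Type*} [MeasurableSpace Ω] {P : Measure Ω}

lemma filter_label_eq {α : Type*} [Fintype α] [DecidableEq α]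
    (π : Finpartition (Finset.univ : Finset α)) (C : {C // C ∈ π.parts}) :
    (Finset.univ.filter fun a => label π a = C) = C.1 := by
  ext a
  simp only [Finset.mem_filter, Finset.mem_univ, true_and, label, Subtype.ext_iff]
  exact π.part_eq_iff_mem C.2

/-- A product of moments over the parts of a partition is a moment for independent copies. -/
lemma prod_parts_integral [IsProbabilityMeasure P] {α : Type*} [Fintype α] [DecidableEq α]
    (π : Finpartition (Finset.univ : Finset α)) (Z : α → Ω → ℝ) :
    ∏ C ∈ π.parts, ∫ ω, ∏ i ∈ C, Z i ω ∂P
      = ∫ x : {C // C ∈ π.parts} → Ω, ∏ i, Z i (x (label π i)) ∂(Measure.pi fun _ => P) := by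
  rw [← Finset.prod_coe_sort π.parts fun C => ∫ ω, ∏ i ∈ C, Z i ω ∂P,
    ← integral_fintype_prod_eq_prod (fun (C : {C // C ∈ π.parts}) ω => ∏ i ∈ C.1, Z i ω)]
  congr 1
  funext x
  rw [← Finset.prod_fiberwise Finset.univ (label π) fun i => Z i (x (label π i))]
  refine Finset.prod_congr rfl fun C _ => ?_
  rw [filter_label_eq]
  refine Finset.prod_congr rfl fun i hi => ?_
  rw [show label π i = C from Subtype.ext ((π.part_eq_iff_mem C.2).2 hi)]

/-- Multilinearity of the joint cumulants. -/
lemma jointCumulant_sum [IsProbabilityMeasure P] {r : ℕ} {J : Type*} [Fintype J]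
    (f : Fin r → J → Ω → ℝ)
    (hf : ∀ k j, BddMeas (f k j)) :
    jointCumulant P (fun k ω => ∑ j, f k j ω)
      = ∑ c : Fin r → J, jointCumulant P (fun k => f k (c k)) := by
  classical
  unfold jointCumulant
  rw [Finset.sum_comm]
  refine Finset.sum_congr rfl fun π _ => ?_
  rw [← Finset.mul_sum]
  congr 1
  -- Independent copies turn each product of moments into one integral, under which the product of
  -- sums can be expanded.
  simp_rw [prod_parts_integral]
  rw [← integral_finsetSum]
  · congr 1
    funext x
    exact Fintype.prod_sum fun i j => f i j (x (label π i))
  · intro c _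
    exact (bddMeas_prod _ fun i _ => (hf i (c i)).comp (measurable_pi_apply _)).integrable _

lemma jointCumulant_eq_momentPoly_coeff {r : ℕ} [NeZero r] (Z : Fin r → Ω → ℝ) :
    jointCumulant P Z = (momentPoly fun C => ∫ ω, ∏ i ∈ C, Z i ω ∂P).coeff 1 :=
  (momentPoly_coeff_one _).symm

lemma jointCumulant_eq_zero_of_const [IsProbabilityMeasure P] {r : ℕ} (hr : 2 ≤ r)
    (Z : Fin r → Ω → ℝ) (k : Fin r) (c : ℝ)
    (hk : ∀ ω, Z k ω = c) : jointCumulant P Z = 0 := by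
  have : NeZero r := ⟨by omega⟩
  have : Nontrivial (Fin r) := Fin.nontrivial_iff_two_le.2 hr
  rw [jointCumulant_eq_momentPoly_coeff]
  refine momentPoly_coeff_one_eq_zero _ (by simp) k c fun C hC => ?_
  rw [← integral_const_mul]
  congr 1
  funext ω
  rw [← Finset.mul_prod_erase _ _ hC, hk]

lemma jointCumulant_add_const [IsProbabilityMeasure P] {r : ℕ} (hr : 2 ≤ r)
    (Z : Fin r → Ω → ℝ) (hZ : ∀ k, BddMeas (Z k))
    (c : ℝ) : jointCumulant P (fun k ω => Z k ω + c) = jointCumulant P Z := by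
  -- Each slot chooses between the variable and the constant; every choice other than all variables
  -- has a constant entry, so its cumulant is zero.
  have h := jointCumulant_sum (P := P) (fun k (b : Bool) ω => if b then Z k ω else c)
    (fun k b => by
      cases b
      · simpa using bddMeas_const c
      · simpa using hZ k)
  simp only [Fintype.sum_bool, if_true, Bool.false_eq_true, if_false] at h
  rw [h, Fintype.sum_eq_single fun _ => true]
  · simp
  · intro b hb
    obtain ⟨k, hk⟩ := Function.ne_iff.1 hb
    refine jointCumulant_eq_zero_of_const hr _ k c fun ω => ?_
    simp [Bool.eq_false_iff.2 hk]

lemma finpartition_fin_one (π : Finpartition (Finset.univ : Finset (Fin 1))) :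
    π = Finpartition.indiscrete Finset.univ_nonempty.ne_empty :=
  finpartition_ext_part fun a b => by
    rw [Subsingleton.elim b a]
    simp

lemma jointCumulant_one (Z : Fin 1 → Ω → ℝ) : jointCumulant P Z = ∫ ω, Z 0 ω ∂P := by
  unfold jointCumulant
  rw [Fintype.sum_eq_single (Finpartition.indiscrete Finset.univ_nonempty.ne_empty)
    fun π hπ => absurd (finpartition_fin_one π) hπ]
  simp

lemma finpartition_fin_two (π : Finpartition (Finset.univ : Finset (Fin 2)))
    (h : π ≠ Finpartition.indiscrete Finset.univ_nonempty.ne_empty) : π = ⊥ := by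
  have key : ∀ a b : Fin 2, b ∈ π.part a ↔ a = b := by
    have h01 : (1 : Fin 2) ∉ π.part 0 := by
      intro h01
      have hu : π.part 0 = Finset.univ := by
        ext b
        fin_cases b <;> simp [h01]
      apply h
      have hm : Finset.univ ∈ π.parts := by
        have hm := π.part_mem.2 (Finset.mem_univ 0)
        rwa [hu] at hm
      ext C
      simp only [Finpartition.indiscrete_parts, Finset.mem_singleton]
      constructor
      · intro hC
        obtain ⟨a, ha⟩ := π.nonempty_of_mem_parts hC
        exact π.eq_of_mem_parts hC hm ha (Finset.mem_univ a)
      · rintro rfl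
        exact hm
    have h10 : (0 : Fin 2) ∉ π.part 1 := by
      rw [Finpartition.mem_part_iff_part_eq_part _ (Finset.mem_univ _) (Finset.mem_univ _)] at h01 ⊢
      exact fun h => h01 h.symm
    intro a b
    fin_cases a <;> fin_cases b <;> simp [h01, h10]
  refine finpartition_ext_part fun a b => ?_
  rw [key, Finpartition.mem_part_iff_exists]
  simp only [Finpartition.mem_bot_iff, Finset.mem_univ, true_and]
  constructor
  · rintro rfl
    exact ⟨{a}, ⟨a, rfl⟩, by simp⟩
  · rintro ⟨_, ⟨c, rfl⟩, h1, h2⟩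
    simp_all

lemma jointCumulant_two (Z : Fin 2 → Ω → ℝ) :
    jointCumulant P Z = ∫ ω, Z 0 ω * Z 1 ω ∂P - (∫ ω, Z 0 ω ∂P) * ∫ ω, Z 1 ω ∂P := by
  unfold jointCumulant
  have hne : (Finpartition.indiscrete Finset.univ_nonempty.ne_empty :
      Finpartition (Finset.univ : Finset (Fin 2))) ≠ ⊥ := by
    intro h
    have := congrArg (fun π => π.parts.card) h
    simp at this
  rw [Fintype.sum_eq_add _ _ hne fun π hπ => absurd (finpartition_fin_two π hπ.1) hπ.2]
  simp [Finpartition.parts_bot]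
  ring

lemma variance_eq_jointCumulant [IsProbabilityMeasure P] {Z : Ω → ℝ} (hZ : BddMeas Z) :
    variance Z P = jointCumulant P (fun _ : Fin 2 => Z) := by
  rw [jointCumulant_two, variance_eq_sub]
  · simp [pow_two]
  · obtain ⟨hm, B, hB⟩ := hZ
    exact MemLp.of_bound hm.aestronglyMeasurable B (ae_of_all _ hB)

end JointCumulants

/-! ### The moment-cumulant correspondence -/

section MomentCumulant

/-- The cumulants as functions of the moments. -/
def cumulantOfMoments (m : ℕ → ℝ) (r : ℕ) : ℝ :=
  ∑ π : Finpartition (Finset.univ : Finset (Fin r)),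
    (-1 : ℝ) ^ (π.parts.card - 1) * ((π.parts.card - 1).factorial : ℝ) *
      ∏ C ∈ π.parts, m C.card

lemma jointCumulant_eq_cumulantOfMoments {Ω : Type*} [MeasurableSpace Ω] (P : Measure Ω)
    (Z : Ω → ℝ) (r : ℕ) :
    jointCumulant P (fun _ : Fin r => Z) = cumulantOfMoments (fun k => ∫ ω, Z ω ^ k ∂P) r := by
  simp [jointCumulant, cumulantOfMoments, Finset.prod_const]

lemma cumulant_eq_cumulantOfMoments (ν : Measure ℝ) (r : ℕ) :
    cumulant ν r = cumulantOfMoments (fun k => ∫ x, x ^ k ∂ν) r :=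
  jointCumulant_eq_cumulantOfMoments ν id r

lemma tendsto_cumulantOfMoments {m : ℕ → ℕ → ℝ} {m' : ℕ → ℝ}
    (h : ∀ k, Tendsto (fun n => m n k) atTop (𝓝 (m' k))) (r : ℕ) :
    Tendsto (fun n => cumulantOfMoments (m n) r) atTop (𝓝 (cumulantOfMoments m' r)) :=
  tendsto_finsetSum _ fun _ _ =>
    Tendsto.const_mul _ (tendsto_finsetProd _ fun _ _ => h _)

/-- The moments are determined by the cumulants. -/
lemma moments_eq_of_cumulants_eq {m m' : ℕ → ℝ} (h0 : m 0 = m' 0)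
    (h : ∀ r, 1 ≤ r → cumulantOfMoments m r = cumulantOfMoments m' r) (k : ℕ) : m k = m' k := by
  induction k using Nat.strong_induction_on with
  | _ k ih =>
    rcases Nat.eq_zero_or_pos k with rfl | hk
    · exact h0
    have : NeZero k := ⟨hk.ne'⟩
    have hk' := h k hk
    unfold cumulantOfMoments at hk'
    -- The one-part partition contributes `m k` with coefficient one; all the others involve only
    -- moments of lower order, known by induction.
    let τ : Finpartition (Finset.univ : Finset (Fin k)) :=
      Finpartition.indiscrete Finset.univ_nonempty.ne_empty
    rw [← Finset.add_sum_erase _ _ (Finset.mem_univ τ),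
      ← Finset.add_sum_erase (a := τ) _ _ (Finset.mem_univ τ)] at hk'
    have hrest : ∀ π ∈ Finset.univ.erase τ, ∀ C ∈ π.parts, C.card < k := by
      intro π hπ C hC
      have hle : C.card ≤ k := by simpa using Finset.card_le_univ C
      refine lt_of_le_of_ne hle fun hcard => (Finset.ne_of_mem_erase hπ) ?_
      have hu : C = Finset.univ := Finset.eq_univ_of_card C (by simpa using hcard)
      subst hu
      ext D
      simp only [τ, Finpartition.indiscrete_parts, Finset.mem_singleton]
      constructor
      · intro hD
        obtain ⟨a, ha⟩ := π.nonempty_of_mem_parts hD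
        exact π.eq_of_mem_parts hD hC ha (Finset.mem_univ a)
      · rintro rfl
        exact hC
    rw [Finset.sum_congr rfl fun π hπ => by
      rw [Finset.prod_congr rfl fun C hC => ih _ (hrest π hπ C hC)]] at hk'
    simpa [τ] using add_right_cancel hk'

end MomentCumulant

/-! ### Coordinates of product measures -/

section ProductMeasures

variable {X : Type*} [MeasurableSpace X] {μ : Measure X} [IsProbabilityMeasure μ]

lemma measurePreserving_family {Ω : Type*} [MeasurableSpace Ω] {P : Measure Ω}
    [IsProbabilityMeasure P] {κ : Type*} {ξ : κ → Ω → X} (hmeas : ∀ i, Measurable (ξ i))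
    (hindep : iIndepFun ξ P) (hlaw : ∀ i, P.map (ξ i) = μ)
    {ι : Type*} [Fintype ι] {j : ι → κ} (hj : Function.Injective j) :
    MeasurePreserving (fun ω i => ξ (j i) ω) P (Measure.pi fun _ : ι => μ) := by
  refine ⟨measurable_pi_lambda _ fun i => hmeas _, ?_⟩
  have h := hindep.precomp hj
  rw [iIndepFun_iff_map_fun_eq_pi_map fun i => (hmeas (j i)).aemeasurable] at h
  rw [show (fun ω i => ξ (j i) ω) = fun ω i => (ξ ∘ j) i ω from rfl]
  simp_rw [Function.comp_apply] at h ⊢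
  rw [h]
  simp_rw [hlaw]

lemma measurePreserving_comp_injective {ι κ : Type*} [Fintype ι] [Fintype κ] {j : ι → κ}
    (hj : Function.Injective j) :
    MeasurePreserving (fun (x : κ → X) i => x (j i)) (Measure.pi fun _ : κ => μ)
      (Measure.pi fun _ : ι => μ) :=
  measurePreserving_family (ξ := fun k (x : κ → X) => x k) (fun k => measurable_pi_apply k)
    (iIndepFun_pi (X := fun _ => id) fun _ => aemeasurable_id)
    (fun k => (measurePreserving_eval (fun _ : κ => μ) k).map_eq) hj

lemma integral_comp_measurePreserving {Ω Ω' : Type*} [MeasurableSpace Ω] [MeasurableSpace Ω']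
    {P : Measure Ω} {P' : Measure Ω'} {T : Ω → Ω'} (hT : MeasurePreserving T P P') {F : Ω' → ℝ}
    (hF : Measurable F) : ∫ ω, F (T ω) ∂P = ∫ ω', F ω' ∂P' := by
  rw [← hT.map_eq, integral_map hT.aemeasurable hF.aestronglyMeasurable]

end ProductMeasures

/-! ### Expansion of moments and cumulants of `S_n` over partitions -/

section Expansions

variable {X : Type*} [MetricSpace X] [CompactSpace X] [MeasurableSpace X] [BorelSpace X]
  {μ : Measure X} [IsProbabilityMeasure μ]

lemma continuous_distVec {p : ℕ} : Continuous (distVec : (Fin p → X) → Pairs p → ℝ) := by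
  unfold distVec
  fun_prop

lemma bddMeas_obs {p : ℕ} (φ : C(Pairs p → ℝ, ℝ)) :
    BddMeas (fun x : Fin p → X => φ (distVec x)) := by
  have hc : Continuous (fun x : Fin p → X => φ (distVec x)) := φ.continuous.comp continuous_distVec
  refine ⟨hc.measurable, ?_⟩
  obtain ⟨B, hB⟩ := isCompact_univ.exists_bound_of_continuousOn hc.continuousOn
  exact ⟨B, fun x => hB x (Set.mem_univ x)⟩

lemma bddMeas_obs_comp {p : ℕ} (φ : C(Pairs p → ℝ, ℝ)) {ι : Type*} (I : Fin p → ι) :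
    BddMeas (fun x : ι → X => φ (distVec fun l => x (I l))) :=
  (bddMeas_obs φ).comp (measurable_pi_lambda _ fun l => measurable_pi_apply (I l))

/-- The joint moment attached to a partition. -/
def partMoment (μ : Measure X) {r p : ℕ} (φ : C(Pairs p → ℝ, ℝ)) (π : SetPart r p) : ℝ :=
  ∫ x : {C // C ∈ π.parts} → X, ∏ k : Fin r, φ (distVec fun l => x (label π (k, l)))
    ∂(Measure.pi fun _ => μ)

variable {Ω : Type*} [MeasurableSpace Ω] {P : Measure Ω} [IsProbabilityMeasure P]
  {ξ : ℕ → Ω → X}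

lemma bddMeas_sampleSum (hmeas : ∀ i, Measurable (ξ i)) {p : ℕ} (φ : C(Pairs p → ℝ, ℝ)) (n : ℕ) :
    BddMeas (fun ω => sampleSum φ (fun i => ξ i ω) n) :=
  bddMeas_sum _ fun I _ => (bddMeas_obs φ).comp (measurable_pi_lambda _ fun l => hmeas (I l))

/-- For i.i.d. points only the pattern of coincidences among the indices matters: the distinct
indices are an injective image of the parts, and the corresponding points have the product law. -/
lemma integral_comp_index (hmeas : ∀ i, Measurable (ξ i)) (hindep : iIndepFun ξ P)
    (hlaw : ∀ i, P.map (ξ i) = μ) {α : Type*} [Fintype α] [DecidableEq α] {n : ℕ} (I : α → Fin n)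
    {F : (α → X) → ℝ} (hF : Measurable F) :
    ∫ ω, F (fun a => ξ (I a) ω) ∂P
      = ∫ x : {C // C ∈ (kerPart I).parts} → X, F (fun a => x (label (kerPart I) a))
          ∂(Measure.pi fun _ => μ) := by
  obtain ⟨j, hj⟩ := exists_embedding_of_kerPart I
  have hT := measurePreserving_family hmeas hindep hlaw (j := fun C => (j C : ℕ))
    (Fin.val_injective.comp j.injective)
  rw [← integral_comp_measurePreserving hT]
  · congr 1
    funext ω
    congr 1
    funext a
    rw [congrFun hj a]
    rfl
  · exact hF.comp (measurable_pi_lambda _ fun a => measurable_pi_apply _)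

lemma jointCumulant_index (hmeas : ∀ i, Measurable (ξ i)) (hindep : iIndepFun ξ P)
    (hlaw : ∀ i, P.map (ξ i) = μ) {r p : ℕ} (φ : C(Pairs p → ℝ, ℝ)) {n : ℕ}
    (I : Fin r × Fin p → Fin n) :
    jointCumulant P (fun k ω => φ (distVec fun l => ξ (I (k, l)) ω))
      = kappa μ φ (kerPart I) := by
  unfold kappa jointCumulant
  refine Finset.sum_congr rfl fun π _ => ?_
  congr 1
  refine Finset.prod_congr rfl fun C _ => ?_
  refine integral_comp_index hmeas hindep hlaw I
    (F := fun z => ∏ k ∈ C, φ (distVec fun l => z (k, l))) ?_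
  exact (bddMeas_prod C fun k _ => bddMeas_obs_comp φ fun l => (k, l)).1

/-- The expansion of the cumulants of the sums `S_n`. -/
lemma jointCumulant_sampleSum (hmeas : ∀ i, Measurable (ξ i)) (hindep : iIndepFun ξ P)
    (hlaw : ∀ i, P.map (ξ i) = μ) {p : ℕ} (φ : C(Pairs p → ℝ, ℝ)) (r n : ℕ) :
    jointCumulant P (fun (_ : Fin r) ω => sampleSum φ (fun i => ξ i ω) n)
      = ∑ π : SetPart r p, (n.descFactorial π.parts.card : ℝ) * kappa μ φ π := by
  unfold sampleSum
  rw [jointCumulant_sum (fun _ (I : Fin p → Fin n) ω => φ (distVec fun l => ξ (I l) ω))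
    fun _ I => (bddMeas_obs φ).comp (measurable_pi_lambda _ fun l => hmeas (I l)),
    ← sum_comp_kerPart, ← (Equiv.curry (Fin r) (Fin p) (Fin n)).sum_comp]
  refine Finset.sum_congr rfl fun I _ => ?_
  exact jointCumulant_index hmeas hindep hlaw φ I

/-- The expansion of the moments of the sums `S_n`. -/
lemma integral_sampleSum_pow (hmeas : ∀ i, Measurable (ξ i)) (hindep : iIndepFun ξ P)
    (hlaw : ∀ i, P.map (ξ i) = μ) {p : ℕ} (φ : C(Pairs p → ℝ, ℝ)) (r n : ℕ) :
    ∫ ω, sampleSum φ (fun i => ξ i ω) n ^ r ∂P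
      = ∑ π : SetPart r p, (n.descFactorial π.parts.card : ℝ) * partMoment μ φ π := by
  have hexp : ∀ ω, sampleSum φ (fun i => ξ i ω) n ^ r
      = ∑ I : Fin r × Fin p → Fin n, ∏ k, φ (distVec fun l => ξ (I (k, l)) ω) := by
    intro ω
    rw [← (Equiv.curry (Fin r) (Fin p) (Fin n)).symm.sum_comp, sampleSum]
    have := Fintype.prod_sum fun (_ : Fin r) (I : Fin p → Fin n) =>
      φ (distVec fun l => ξ (I l) ω)
    simp only [Finset.prod_const, Finset.card_univ, Fintype.card_fin] at this
    exact this
  simp_rw [hexp]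
  rw [integral_finsetSum, ← sum_comp_kerPart]
  · refine Finset.sum_congr rfl fun I _ => ?_
    exact integral_comp_index hmeas hindep hlaw I
      (F := fun z => ∏ k, φ (distVec fun l => z (k, l)))
      (bddMeas_prod _ fun k _ => bddMeas_obs_comp φ fun l => (k, l)).1
  · intro I _
    exact (bddMeas_prod _ fun k _ =>
      (bddMeas_obs φ).comp (measurable_pi_lambda _ fun l => hmeas _)).integrable P

lemma kappa_add_const {r p : ℕ} (hr : 2 ≤ r) (φ : C(Pairs p → ℝ, ℝ)) (c : ℝ) (π : SetPart r p) :
    kappa μ (φ + ContinuousMap.const _ c) π = kappa μ φ π :=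
  jointCumulant_add_const hr (fun k (x : {C // C ∈ π.parts} → X) =>
    φ (distVec fun l => x (partLabel π (k, l)))) (fun _ => bddMeas_obs_comp φ _) c

end Expansions

/-! ### Observables of the empirical measure -/

section Empirical

variable {X : Type*} [MetricSpace X] [CompactSpace X] [MeasurableSpace X] [BorelSpace X]

lemma pi_empMeasure (x : ℕ → X) {n : ℕ} (hn : 1 ≤ n) (p : ℕ) :
    (Measure.pi fun _ : Fin p => empMeasure x n)
      = ((n : ℝ≥0∞)⁻¹) ^ p • ∑ I : Fin p → Fin n, Measure.dirac fun l => x (I l) := by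
  classical
  have hfin : IsFiniteMeasure (empMeasure x n) := by
    refine ⟨?_⟩
    rw [empMeasure, Measure.smul_apply, Measure.finsetSum_apply]
    simp only [measure_univ, smul_eq_mul]
    refine ENNReal.mul_lt_top ?_ (by simp)
    simp only [ENNReal.inv_lt_top, Nat.cast_pos]
    omega
  refine Measure.pi_eq fun s hs => ?_
  have h1 : ∀ l, empMeasure x n (s l)
      = (n : ℝ≥0∞)⁻¹ * ∑ i : Fin n, (s l).indicator 1 (x i) := by
    intro l
    rw [empMeasure, Measure.smul_apply, Measure.finsetSum_apply, smul_eq_mul,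
      ← Fin.sum_univ_eq_sum_range (fun i => Measure.dirac (x i) (s l)) n]
    congr 1
    exact Finset.sum_congr rfl fun i _ => Measure.dirac_apply' _ (hs l)
  simp_rw [h1]
  rw [Finset.prod_mul_distrib, Finset.prod_const, Finset.card_univ, Fintype.card_fin,
    Measure.smul_apply, smul_eq_mul, Measure.finsetSum_apply, Fintype.prod_sum]
  congr 1
  refine Finset.sum_congr rfl fun I _ => ?_
  rw [Measure.dirac_apply' _ (MeasurableSet.univ_pi hs)]
  simp [Set.indicator_apply, Finset.prod_ite_zero]

lemma polyObs_empMeasure {p : ℕ} (φ : C(Pairs p → ℝ, ℝ)) (x : ℕ → X) {n : ℕ} (hn : 1 ≤ n) :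
    polyObs φ (empMeasure x n) = sampleSum φ x n / (n : ℝ) ^ p := by
  rw [polyObs, pi_empMeasure x hn, integral_smul_measure, integral_finsetSum_measure]
  · have h : ∀ I : Fin p → Fin n, ∫ y, φ (distVec y) ∂(Measure.dirac fun l => x (I l))
        = φ (distVec fun l => x (I l)) := fun I =>
      integral_dirac' _ _ (bddMeas_obs φ).1.stronglyMeasurable
    simp_rw [h]
    rw [sampleSum, div_eq_inv_mul, smul_eq_mul]
    simp
  · intro I _
    exact (bddMeas_obs φ).integrable _

end Empirical

/-! ### Transitivity and the vanishing of partitions with a free row -/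

section Homogeneity

/-- Measure-preserving isometries act transitively. -/
def IsHomogeneous {X : Type*} [MetricSpace X] [MeasurableSpace X] (μ : Measure X) : Prop :=
  ∀ x y : X, ∃ T : X → X, (∀ a b, dist (T a) (T b) = dist a b) ∧ MeasurePreserving T μ μ ∧ T x = y

lemma IsCompactHomogeneous.compactSpace {X : Type*} [MetricSpace X] [MeasurableSpace X]
    {μ : Measure X} (hX : IsCompactHomogeneous X μ) : CompactSpace X := by
  obtain ⟨G, _, _, _, _, _, _, _, K, η, e, -⟩ := hX
  exact e.compactSpace

/-- The maps are the left translations of `G ⧸ K`. They lift to left translations of `G`, which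
preserve Haar measure, so they preserve its push-forward. -/
lemma IsCompactHomogeneous.isHomogeneous {X : Type*} [MetricSpace X] [MeasurableSpace X]
    [BorelSpace X] {μ : Measure X} (hX : IsCompactHomogeneous X μ) : IsHomogeneous μ := by
  obtain ⟨G, _, _, _, _, _, _, _, K, η, e, -, hη, -, hinv, rfl⟩ := hX
  intro x y
  obtain ⟨a, ha⟩ := QuotientGroup.mk_surjective (e.symm x)
  obtain ⟨b, hb⟩ := QuotientGroup.mk_surjective (e.symm y)
  let g := b * a⁻¹
  let T : X → X := fun z => e (g • e.symm z)
  have hTiso : ∀ u v, dist (T u) (T v) = dist u v := fun u v => by simp [T, hinv]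
  have hTc : Continuous T := (Isometry.of_dist_eq hTiso).continuous
  have hq : Measurable (fun h : G => e (h : G ⧸ K)) :=
    (e.continuous.comp continuous_quotient_mk').measurable
  refine ⟨T, hTiso, ⟨hTc.measurable, ?_⟩, ?_⟩
  · rw [Measure.map_map hTc.measurable hq]
    have : T ∘ (fun h : G => e (h : G ⧸ K)) = (fun h : G => e (h : G ⧸ K)) ∘ (fun h => g * h) := by
      funext h
      simp only [T, Function.comp_apply, Homeomorph.symm_apply_apply]
      rfl
    rw [this, ← Measure.map_map hq (measurable_const_mul g), map_mul_left_eq_self]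
  · have : g • e.symm x = e.symm y := by
      rw [← ha, ← hb]
      change ((g * a : G) : G ⧸ K) = _
      simp [g]
    simp [T, this]

variable {X : Type*} [MetricSpace X] [CompactSpace X] [MeasurableSpace X] [BorelSpace X]
  {μ : Measure X} [IsProbabilityMeasure μ]

open Classical in
/-- A configuration of `p` points with the point of index `l₀` singled out. -/
def insertPoint {p : ℕ} (l₀ : Fin p) (x : X) (y : {l : Fin p // l ≠ l₀} → X) (l : Fin p) : X :=
  if h : l = l₀ then x else y ⟨l, h⟩

lemma measurable_insertPoint {p : ℕ} (l₀ : Fin p) :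
    Measurable (fun z : X × ({l : Fin p // l ≠ l₀} → X) => insertPoint l₀ z.1 z.2) := by
  refine measurable_pi_lambda _ fun l => ?_
  unfold insertPoint
  by_cases h : l = l₀
  · simp only [h, dite_true]
    exact measurable_fst
  · simp only [h, dite_false]
    exact (measurable_pi_apply _).comp measurable_snd

/-- In a homogeneous space, the mean of an observable does not depend on a fixed point. -/
lemma integral_insertPoint_eq (hμ : IsHomogeneous μ) {p : ℕ} (φ : C(Pairs p → ℝ, ℝ)) (l₀ : Fin p)
    (x x' : X) :
    ∫ y, φ (distVec (insertPoint l₀ x y)) ∂(Measure.pi fun _ => μ)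
      = ∫ y, φ (distVec (insertPoint l₀ x' y)) ∂(Measure.pi fun _ => μ) := by
  obtain ⟨T, hT, hTμ, rfl⟩ := hμ x x'
  have hmp := measurePreserving_pi (fun _ : {l : Fin p // l ≠ l₀} => μ) (fun _ => μ) fun _ => hTμ
  rw [← integral_comp_measurePreserving hmp
    (F := fun y => φ (distVec (insertPoint l₀ (T x) y)))]
  · congr 1
    funext y
    congr 1
    funext q
    have h : ∀ l, insertPoint l₀ (T x) (fun i => T (y i)) l = T (insertPoint l₀ x y l) := by
      intro l
      unfold insertPoint
      split_ifs <;> rfl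
    simp only [distVec, h, hT]
  · exact (bddMeas_obs φ).1.comp ((measurable_insertPoint l₀).comp measurable_prodMk_left)

/-- If all points but one of a configuration are free, the observable is uncorrelated with any
function of the other points. -/
lemma integral_mul_of_free_row (hμ : IsHomogeneous μ) {p : ℕ} (φ : C(Pairs p → ℝ, ℝ))
    (l₀ : Fin p) {ι : Type*} [Fintype ι] (I : Fin p → ι)
    (hI : ∀ l l', l ≠ l₀ → I l = I l' → l = l') {W : (ι → X) → ℝ} (hW : BddMeas W)
    (hdep : ∀ x x' : ι → X, (∀ i, (∀ l, l ≠ l₀ → I l ≠ i) → x i = x' i) → W x = W x') :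
    ∫ x : ι → X, φ (distVec fun l => x (I l)) * W x ∂(Measure.pi fun _ => μ)
      = (∫ x : ι → X, φ (distVec fun l => x (I l)) ∂(Measure.pi fun _ => μ))
        * ∫ x, W x ∂(Measure.pi fun _ => μ) := by
  classical
  obtain ⟨x₀⟩ : Nonempty X := nonempty_of_isProbabilityMeasure μ
  let c := ∫ y, φ (distVec (insertPoint l₀ x₀ y)) ∂(Measure.pi fun _ => μ)
  suffices h : ∀ W : (ι → X) → ℝ, BddMeas W →
      (∀ x x' : ι → X, (∀ i, (∀ l, l ≠ l₀ → I l ≠ i) → x i = x' i) → W x = W x') →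
      ∫ x : ι → X, φ (distVec fun l => x (I l)) * W x ∂(Measure.pi fun _ => μ)
        = c * ∫ x, W x ∂(Measure.pi fun _ => μ) by
    -- The case `W = 1` identifies `c` with the mean of the observable.
    have h1 := h (fun _ => 1) (bddMeas_const 1) (fun _ _ _ => rfl)
    simp only [mul_one, integral_const, probReal_univ, smul_eq_mul] at h1
    rw [h W hW hdep, h1]
  clear hW hdep W
  intro W hW hdep
  -- The coordinates satisfying `q` are those carried by the free points of the row. `W` ignores
  -- them, so they are integrated first, with the remaining coordinates frozen.
  let q : ι → Prop := fun i => ∃ l, l ≠ l₀ ∧ I l = i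
  let e := MeasurableEquiv.piEquivPiSubtypeProd (fun _ : ι => X) q
  have he := (measurePreserving_piEquivPiSubtypeProd (fun _ : ι => μ) q).symm
  let j : {l : Fin p // l ≠ l₀} → {i // q i} := fun l => ⟨I l, l, l.2, rfl⟩
  have hj : Function.Injective j := fun l l' h =>
    Subtype.ext (hI l l' l.2 (congrArg Subtype.val h))
  have ho : ¬ q (I l₀) := fun ⟨l, hl, h⟩ => hl (hI l l₀ hl h)
  let o : {i // ¬ q i} := ⟨I l₀, ho⟩
  have hval : ∀ (z : ({i // q i} → X) × ({i // ¬ q i} → X)) (i : ι),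
      e.symm z i = if h : q i then z.1 ⟨i, h⟩ else z.2 ⟨i, h⟩ := fun z i => rfl
  have hrow : ∀ z : ({i // q i} → X) × ({i // ¬ q i} → X),
      (fun l => e.symm z (I l)) = insertPoint l₀ (z.2 o) (fun l => z.1 (j l)) := by
    intro z
    funext l
    unfold insertPoint
    split_ifs with h
    · subst h
      rw [hval, dif_neg ho]
    · rw [hval, dif_pos (⟨l, h, rfl⟩ : q (I l))]
  have hWz : ∀ z : ({i // q i} → X) × ({i // ¬ q i} → X),
      W (e.symm z) = W (e.symm (fun _ => x₀, z.2)) := by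
    intro z
    refine hdep _ _ fun i hi => ?_
    have : ¬ q i := fun ⟨l, hl, h⟩ => hi l hl h
    rw [hval, hval, dif_neg this, dif_neg this]
  have hmW : BddMeas fun b : {i // ¬ q i} → X => W (e.symm (fun _ => x₀, b)) :=
    hW.comp (e.symm.measurable.comp measurable_prodMk_left)
  have hZb : BddMeas fun z : ({i // q i} → X) × ({i // ¬ q i} → X) =>
      φ (distVec fun l => e.symm z (I l)) :=
    (bddMeas_obs_comp φ I).comp e.symm.measurable
  rw [← integral_comp_measurePreserving he hW.1,
    ← integral_comp_measurePreserving he ((bddMeas_obs_comp φ I).mul hW).1]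
  change ∫ z, φ (distVec fun l => e.symm z (I l)) * W (e.symm z) ∂_ = c * ∫ z, W (e.symm z) ∂_
  have hWe : BddMeas fun z => W (e.symm z) := hW.comp e.symm.measurable
  rw [integral_prod_symm _ ((hZb.mul hWe).integrable _),
    integral_prod_symm _ (hWe.integrable _), ← integral_const_mul]
  congr 1
  funext b
  simp_rw [hWz (_, b)]
  rw [integral_mul_const, integral_const, probReal_univ, one_smul]
  congr 1
  simp_rw [hrow]
  rw [integral_comp_measurePreserving (measurePreserving_comp_injective hj)
    (F := fun y => φ (distVec (insertPoint l₀ (b o) y)))]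
  · exact integral_insertPoint_eq hμ φ l₀ _ _
  · exact (bddMeas_obs φ).1.comp ((measurable_insertPoint l₀).comp measurable_prodMk_left)

lemma HomVanishing.exists_free_row {r p : ℕ} (hp : 1 ≤ p) {π : SetPart r p}
    (h : HomVanishing π) : ∃ (k : Fin r) (l₀ : Fin p), ∀ l, l ≠ l₀ → {(k, l)} ∈ π.parts := by
  obtain ⟨k, hk⟩ := h
  refine ⟨k, ?_⟩
  by_contra! hcon
  obtain ⟨l₁, -, hl₁⟩ := hcon ⟨0, hp⟩
  obtain ⟨l₂, h12, hl₂⟩ := hcon l₁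
  have hsub : (Finset.univ.filter fun l : Fin p => {(k, l)} ∈ π.parts)
      ⊆ (Finset.univ.erase l₁).erase l₂ := by
    intro l hl
    have hl := (Finset.mem_filter.1 hl).2
    simp only [Finset.mem_erase, Finset.mem_univ, and_true]
    exact ⟨fun h => hl₂ (h ▸ hl), fun h => hl₁ (h ▸ hl)⟩
  have hc := Finset.card_le_card hsub
  rw [Finset.card_erase_of_mem (by simp [h12]), Finset.card_erase_of_mem (Finset.mem_univ _),
    Finset.card_univ, Fintype.card_fin] at hc
  have hp2 : 2 ≤ p := by
    by_contra hlt
    exact h12 (by ext; omega)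
  omega

lemma eq_of_label_eq_of_singleton {α : Type*} [Fintype α] [DecidableEq α]
    {π : Finpartition (Finset.univ : Finset α)} {a b : α} (ha : {a} ∈ π.parts)
    (h : label π a = label π b) : a = b := by
  rw [label_eq_label_iff, π.part_eq_of_mem ha (Finset.mem_singleton_self a),
    Finset.mem_singleton] at h
  exact h.symm

/-- Joint moments involving a free row vanish for a centred observable. -/
lemma HomVanishing.exists_integral_eq_zero (hμ : IsHomogeneous μ) {r p : ℕ} (hp : 1 ≤ p)
    {φ : C(Pairs p → ℝ, ℝ)} (hφ : polyObs φ μ = 0) {π : SetPart r p} (h : HomVanishing π) :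
    ∃ k : Fin r, ∀ C : Finset (Fin r), k ∈ C →
      ∫ x : {C // C ∈ π.parts} → X, ∏ i ∈ C, φ (distVec fun l => x (label π (i, l)))
        ∂(Measure.pi fun _ => μ) = 0 := by
  obtain ⟨k, l₀, hk⟩ := h.exists_free_row hp
  refine ⟨k, fun C hC => ?_⟩
  have hinj : Function.Injective fun l => label π (k, l) := by
    intro l l' hll
    by_cases hl : l = l₀
    · by_cases hl' : l' = l₀
      · rw [hl, hl']
      · exact (Prod.ext_iff.1 (eq_of_label_eq_of_singleton (hk l' hl') hll.symm)).2.symm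
    · exact (Prod.ext_iff.1 (eq_of_label_eq_of_singleton (hk l hl) hll)).2
  have hz : ∫ x : {C // C ∈ π.parts} → X, φ (distVec fun l => x (label π (k, l)))
      ∂(Measure.pi fun _ => μ) = 0 := by
    rw [← hφ, polyObs]
    exact integral_comp_measurePreserving (measurePreserving_comp_injective hinj)
      (F := fun y => φ (distVec y)) (bddMeas_obs φ).1
  simp_rw [← Finset.mul_prod_erase C _ hC]
  rw [integral_mul_of_free_row hμ φ l₀ (fun l => label π (k, l)), hz, zero_mul]
  · intro l l' _ hll
    exact hinj hll
  · exact bddMeas_prod _ fun i _ => bddMeas_obs_comp φ _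
  · intro x x' hxx'
    refine Finset.prod_congr rfl fun i hi => ?_
    congr 2
    funext l
    refine hxx' _ fun l' hl' hll' => ?_
    exact (Finset.ne_of_mem_erase hi).symm
      (Prod.ext_iff.1 (eq_of_label_eq_of_singleton (hk l' hl') hll')).1

lemma HomVanishing.partMoment_eq_zero (hμ : IsHomogeneous μ) {r p : ℕ} (hp : 1 ≤ p)
    {φ : C(Pairs p → ℝ, ℝ)} (hφ : polyObs φ μ = 0) {π : SetPart r p} (h : HomVanishing π) :
    partMoment μ φ π = 0 := by
  obtain ⟨k, hk⟩ := h.exists_integral_eq_zero hμ hp hφ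
  exact hk Finset.univ (Finset.mem_univ k)

/-- In every term of the Möbius sum, the moment of the part containing the free row is zero. -/
lemma HomVanishing.kappa_eq_zero (hμ : IsHomogeneous μ) {r p : ℕ} (hp : 1 ≤ p)
    {φ : C(Pairs p → ℝ, ℝ)} (hφ : polyObs φ μ = 0) {π : SetPart r p} (h : HomVanishing π) :
    kappa μ φ π = 0 := by
  obtain ⟨k, hk⟩ := h.exists_integral_eq_zero hμ hp hφ
  unfold kappa jointCumulant
  refine Finset.sum_eq_zero fun σ _ => ?_
  rw [Finset.prod_eq_zero (σ.part_mem.2 (Finset.mem_univ k)), mul_zero]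
  exact hk _ (by simp)

end Homogeneity

/-! ### Extremal partitions: structure and counting -/

section PartitionStructure

variable {α : Type*} [Fintype α] [DecidableEq α]

lemma part_eq_singleton_iff {π : Finpartition (Finset.univ : Finset α)} {a : α} :
    {a} ∈ π.parts ↔ π.part a = {a} := by
  constructor
  · intro h
    exact π.part_eq_of_mem h (Finset.mem_singleton_self a)
  · intro h
    have := π.part_mem.2 (Finset.mem_univ a)
    rwa [h] at this

lemma card_filter_singleton_mem (π : Finpartition (Finset.univ : Finset α)) :
    (Finset.univ.filter fun a => {a} ∈ π.parts).card
      = (π.parts.filter fun C => C.card = 1).card := by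
  refine Finset.card_bij (fun a _ => {a}) ?_ ?_ ?_
  · intro a ha
    simpa using ha
  · intro a _ b _ h
    simpa using h
  · intro C hC
    obtain ⟨hC, h1⟩ := Finset.mem_filter.1 hC
    obtain ⟨a, rfl⟩ := Finset.card_eq_one.1 h1
    exact ⟨a, by simpa using hC, rfl⟩

/-- Twice the number of parts, compared with the number of elements and of singletons. -/
lemma two_mul_card_parts_add (π : Finpartition (Finset.univ : Finset α)) :
    2 * π.parts.card + ∑ C ∈ π.parts, (C.card + (if C.card = 1 then 1 else 0) - 2)
      = Fintype.card α + (Finset.univ.filter fun a => {a} ∈ π.parts).card := by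
  rw [card_filter_singleton_mem, Finset.card_filter, ← Finset.card_univ, ← π.sum_card_parts,
    ← Finset.sum_add_distrib, mul_comm, ← smul_eq_mul, ← Finset.sum_const,
    ← Finset.sum_add_distrib]
  -- The defect of a part is `0` for sizes one and two and `|C| - 2` beyond; parts are nonempty, so
  -- the truncated subtraction loses nothing.
  refine Finset.sum_congr rfl fun C hC => ?_
  have := Finset.card_pos.2 (π.nonempty_of_mem_parts hC)
  split_ifs <;> omega

lemma card_parts_kerPart {β : Type*} [DecidableEq β] (f : α → β) :
    (kerPart f).parts.card = (Finset.univ.image f).card := by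
  obtain ⟨j, hj⟩ := exists_embedding_of_kerPart f
  have : Finset.univ.image f = Finset.univ.map j := by
    ext b
    simp only [Finset.mem_image, Finset.mem_univ, true_and, Finset.mem_map]
    constructor
    · rintro ⟨a, rfl⟩
      exact ⟨label _ a, (congrFun hj a).symm⟩
    · rintro ⟨C, rfl⟩
      obtain ⟨a, rfl⟩ := label_surjective _ C
      exact ⟨a, congrFun hj a⟩
  rw [this, Finset.card_map, Finset.card_univ, Fintype.card_coe]

/-- A partition into parts of size at most two is determined by its parts of size two. -/
lemma finpartition_eq_of_pairs_eq {π σ : Finpartition (Finset.univ : Finset α)}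
    (hπ : ∀ C ∈ π.parts, C.card ≤ 2) (hσ : ∀ C ∈ σ.parts, C.card ≤ 2)
    (h : (π.parts.filter fun C => C.card = 2) = σ.parts.filter fun C => C.card = 2) : π = σ := by
  have key : ∀ π σ : Finpartition (Finset.univ : Finset α), (∀ C ∈ π.parts, C.card ≤ 2) →
      (∀ C ∈ σ.parts, C.card ≤ 2) →
      ((π.parts.filter fun C => C.card = 2) = σ.parts.filter fun C => C.card = 2) →
      π.parts ⊆ σ.parts := by
    intro π σ hπ hσ h C hC
    have hpos := Finset.card_pos.2 (π.nonempty_of_mem_parts hC)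
    have hle := hπ C hC
    by_cases h2 : C.card = 2
    · have : C ∈ σ.parts.filter fun C => C.card = 2 := h ▸ Finset.mem_filter.2 ⟨hC, h2⟩
      exact (Finset.mem_filter.1 this).1
    · obtain ⟨a, rfl⟩ := Finset.card_eq_one.1 (show C.card = 1 by omega)
      have hm := σ.part_mem.2 (Finset.mem_univ a)
      have haσ : a ∈ σ.part a := by simp
      have hpos' := Finset.card_pos.2 ⟨a, haσ⟩
      have hle' := hσ _ hm
      by_cases h2' : (σ.part a).card = 2
      · have hmem : σ.part a ∈ π.parts.filter fun C => C.card = 2 :=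
          h ▸ Finset.mem_filter.2 ⟨hm, h2'⟩
        have := π.eq_of_mem_parts hC (Finset.mem_filter.1 hmem).1 (Finset.mem_singleton_self a) haσ
        rw [← this] at h2'
        simp at h2'
      · obtain ⟨b, hb⟩ := Finset.card_eq_one.1 (show (σ.part a).card = 1 by omega)
        rw [hb, Finset.mem_singleton] at haσ
        subst haσ
        rwa [hb] at hm
  ext1
  exact Finset.Subset.antisymm (key π σ hπ hσ h) (key σ π hσ hπ h.symm)

variable {r p : ℕ}

/-- The number of singletons of `π` in a row. -/
def rowSingletons (π : SetPart r p) (k : Fin r) : ℕ :=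
  (Finset.univ.filter fun l : Fin p => {(k, l)} ∈ π.parts).card

lemma sum_rowSingletons (π : SetPart r p) :
    ∑ k, rowSingletons π k = (Finset.univ.filter fun q => {q} ∈ π.parts).card := by
  simp_rw [rowSingletons, Finset.card_filter]
  rw [Fintype.sum_prod_type]

lemma rowSingletons_add_two_le {π : SetPart r p} (h : ¬ HomVanishing π) (k : Fin r) :
    rowSingletons π k + 2 ≤ p := by
  have : ¬ p - 1 ≤ rowSingletons π k := fun hk => h ⟨k, hk⟩
  omega

lemma sum_rowSingletons_add_le {π : SetPart r p} (h : ¬ HomVanishing π) :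
    ∑ k, rowSingletons π k + 2 * r ≤ r * p := by
  have := Finset.sum_le_sum fun k (_ : k ∈ Finset.univ) => rowSingletons_add_two_le h k
  rw [Finset.sum_add_distrib] at this
  simp only [Finset.sum_const, Finset.card_univ, Fintype.card_fin, smul_eq_mul] at this
  omega

/-- Each row has at most `p - 2` singletons, and twice the number of parts is at most the number of
elements plus the number of singletons: `2ℓ ≤ rp + r(p-2)`. -/
lemma card_parts_le_of_not_homVanishing {π : SetPart r p} (h : ¬ HomVanishing π) :
    π.parts.card ≤ (p - 1) * r := by
  have h1 := two_mul_card_parts_add π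
  rw [← sum_rowSingletons] at h1
  have h2 := sum_rowSingletons_add_le h
  simp only [Fintype.card_prod, Fintype.card_fin] at h1
  rw [Nat.sub_mul, one_mul, mul_comm p r]
  omega

/-- In the extremal case, all the parts have size at most two and each row contains exactly two
elements that are not singletons. -/
lemma extremal_structure {π : SetPart r p} (h : ¬ HomVanishing π)
    (hcard : π.parts.card = (p - 1) * r) :
    (∀ C ∈ π.parts, C.card ≤ 2) ∧ (∀ k, rowSingletons π k + 2 = p) ∧
      (π.parts.filter fun C => C.card = 2).card = r := by
  have h1 := two_mul_card_parts_add π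
  have hs := sum_rowSingletons π
  have h2 := sum_rowSingletons_add_le h
  rw [← sum_rowSingletons, hcard] at h1
  simp only [Fintype.card_prod, Fintype.card_fin] at h1
  rw [Nat.sub_mul, one_mul, mul_comm p r] at h1 hcard
  have hrp : r ≤ r * p := by
    rcases Nat.eq_zero_or_pos r with rfl | hr
    · simp
    · exact Nat.le_mul_of_pos_right r (by have := rowSingletons_add_two_le h ⟨0, hr⟩; omega)
  -- Equality in the bound on the number of parts forces both slacks to vanish: the defects of the
  -- parts and the deficits of singletons in the rows.
  have hzero : ∑ C ∈ π.parts, (C.card + (if C.card = 1 then 1 else 0) - 2) = 0 := by omega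
  have hsum : ∑ k, rowSingletons π k + 2 * r = r * p := by omega
  have hle2 : ∀ C ∈ π.parts, C.card ≤ 2 := by
    intro C hC
    have := (Finset.sum_eq_zero_iff.1 hzero) C hC
    split_ifs at this <;> omega
  refine ⟨hle2, fun k => ?_, ?_⟩
  · refine (Finset.sum_eq_sum_iff_of_le (fun k _ => rowSingletons_add_two_le h k)).1 ?_ k
      (Finset.mem_univ k)
    rw [Finset.sum_add_distrib]
    simp only [Finset.sum_const, Finset.card_univ, Fintype.card_fin, smul_eq_mul]
    omega
  · have hsplit := Finset.card_filter_add_card_filter_not (s := π.parts) (fun C => C.card = 1)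
    have heq : (π.parts.filter fun C => ¬ C.card = 1) = π.parts.filter fun C => C.card = 2 := by
      refine Finset.filter_congr fun C hC => ?_
      have := Finset.card_pos.2 (π.nonempty_of_mem_parts hC)
      have := hle2 C hC
      omega
    rw [heq, ← card_filter_singleton_mem, ← hs, hcard] at hsplit
    omega

-- An extremal partition is recovered from its `r` parts of size two, chosen among the pairs of
-- elements of the `rp`-element set.
open Classical in
lemma card_extremal_le (r p : ℕ) :
    (Finset.univ.filter fun π : SetPart r p =>
      π.parts.card = (p - 1) * r ∧ ¬ HomVanishing π).card ≤ ((r * p).choose 2).choose r := by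
  have hc : (Finset.powersetCard r (Finset.powersetCard 2
      (Finset.univ : Finset (Fin r × Fin p)))).card = ((r * p).choose 2).choose r := by
    simp [Finset.card_powersetCard]
  rw [← hc]
  refine Finset.card_le_card_of_injOn (fun π => π.parts.filter fun C => C.card = 2) ?_ ?_
  · intro π hπ
    obtain ⟨-, h1, h2⟩ := Finset.mem_filter.1 hπ
    refine Finset.mem_coe.2
      (Finset.mem_powersetCard.2 ⟨fun C hC => ?_, (extremal_structure h2 h1).2.2⟩)
    exact Finset.mem_powersetCard.2 ⟨Finset.subset_univ _, (Finset.mem_filter.1 hC).2⟩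
  · intro π hπ σ hσ h
    obtain ⟨-, h1, h2⟩ := Finset.mem_filter.1 hπ
    obtain ⟨-, h1', h2'⟩ := Finset.mem_filter.1 hσ
    exact finpartition_eq_of_pairs_eq (extremal_structure h2 h1).1 (extremal_structure h2' h1').1 h

/-- The count is at most `(rp)^(2r) / r!`, and `r^r ≤ e^r r!` absorbs the powers of `r`, leaving one
factor `r!`. This is the growth compatible with a moment-generating function finite near `0`. -/
lemma choose_choose_le (r p : ℕ) :
    ((((r * p).choose 2).choose r : ℕ) : ℝ) ≤ (p * Real.exp 1) ^ (2 * r) * r.factorial := by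
  have h1 : ((((r * p).choose 2).choose r : ℕ) : ℝ)
      ≤ (((r * p).choose 2 : ℕ) : ℝ) ^ r / r.factorial :=
    Nat.choose_le_pow_div r _
  have h2 : (((r * p).choose 2 : ℕ) : ℝ) ≤ ((r : ℝ) * p) ^ 2 := by
    exact_mod_cast Nat.choose_le_pow (r * p) 2
  have h3 : (r : ℝ) ^ r ≤ Real.exp 1 ^ r * r.factorial := by
    have := Real.pow_div_factorial_le_exp (r : ℝ) (by positivity) r
    rw [div_le_iff₀ (by positivity)] at this
    rwa [← Real.exp_nat_mul, mul_one]
  have hf : (0 : ℝ) < r.factorial := by positivity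
  refine h1.trans ((div_le_iff₀ hf).2 ?_)
  calc (((r * p).choose 2 : ℕ) : ℝ) ^ r ≤ (((r : ℝ) * p) ^ 2) ^ r := by gcongr
    _ = (p : ℝ) ^ (2 * r) * ((r : ℝ) ^ r) ^ 2 := by rw [← pow_mul, mul_pow]; ring
    _ ≤ (p : ℝ) ^ (2 * r) * (Real.exp 1 ^ r * r.factorial) ^ 2 := by gcongr
    _ = _ := by ring

end PartitionStructure

/-! ### Extremal partitions of two rows -/

section DoublePairs

variable {p : ℕ}

lemma mem_part_doublePair {k₁ l₁ k₂ l₂ : Fin p} (hk : k₁ ≠ k₂) (hl : l₁ ≠ l₂)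
    (a b : Fin 2 × Fin p) :
    b ∈ (doublePair k₁ l₁ k₂ l₂).part a ↔ a = b ∨ (a = (0, k₁) ∧ b = (1, l₁)) ∨
      (a = (1, l₁) ∧ b = (0, k₁)) ∨ (a = (0, k₂) ∧ b = (1, l₂)) ∨
      (a = (1, l₂) ∧ b = (0, k₂)) := by
  rw [show doublePair k₁ l₁ k₂ l₂ = kerPart _ from rfl, mem_part_kerPart]
  have h01 : ∀ k l : Fin p, ((0 : Fin 2), k) ≠ (1, l) := by simp
  split_ifs <;> grind

lemma doublePair_swap {k₁ l₁ k₂ l₂ : Fin p} (hk : k₁ ≠ k₂) (hl : l₁ ≠ l₂) :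
    doublePair k₁ l₁ k₂ l₂ = doublePair k₂ l₂ k₁ l₁ :=
  finpartition_ext_part fun a b => by
    rw [mem_part_doublePair hk hl, mem_part_doublePair hk.symm hl.symm]
    tauto

lemma card_parts_doublePair {k₁ l₁ k₂ l₂ : Fin p} (hl : l₁ ≠ l₂) :
    (doublePair k₁ l₁ k₂ l₂).parts.card = (p - 1) * 2 := by
  rw [show doublePair k₁ l₁ k₂ l₂ = kerPart _ from rfl, card_parts_kerPart]
  have h01 : ∀ k l : Fin p, ((0 : Fin 2), k) ≠ (1, l) := by simp
  have himg : (Finset.univ.image fun q : Fin 2 × Fin p =>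
      if q = (1, l₁) then (0, k₁) else if q = (1, l₂) then (0, k₂) else q)
      = (Finset.univ.erase ((1 : Fin 2), l₁)).erase (1, l₂) := by
    ext b
    simp only [Finset.mem_image, Finset.mem_univ, true_and, Finset.mem_erase, and_true]
    constructor
    · rintro ⟨a, rfl⟩
      split_ifs <;> grind
    · rintro ⟨h2, h1⟩
      exact ⟨b, by rw [if_neg h1, if_neg h2]⟩
  rw [himg, Finset.card_erase_of_mem (by simp [hl.symm]),
    Finset.card_erase_of_mem (Finset.mem_univ _), Finset.card_univ]
  simp only [Fintype.card_prod, Fintype.card_fin]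
  omega

lemma card_lt_of_two_missing {s : Finset (Fin p)} {a b : Fin p} (hab : a ≠ b) (ha : a ∉ s)
    (hb : b ∉ s) : s.card < p - 1 := by
  have hsub : s ⊆ (Finset.univ.erase a).erase b := by
    intro c hc
    simp only [Finset.mem_erase, Finset.mem_univ, and_true]
    exact ⟨fun h => hb (h ▸ hc), fun h => ha (h ▸ hc)⟩
  have hc := Finset.card_le_card hsub
  rw [Finset.card_erase_of_mem (by simp [hab.symm]), Finset.card_erase_of_mem (Finset.mem_univ _),
    Finset.card_univ, Fintype.card_fin] at hc
  have hp : 2 ≤ p := by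
    by_contra hlt
    exact hab (by ext; omega)
  omega

lemma singleton_notMem_of_mem_part {α : Type*} [Fintype α] [DecidableEq α]
    {π : Finpartition (Finset.univ : Finset α)} {a b : α} (h : b ∈ π.part a) (hab : b ≠ a) :
    {a} ∉ π.parts := by
  rw [part_eq_singleton_iff]
  intro h'
  rw [h', Finset.mem_singleton] at h
  exact hab h

lemma not_homVanishing_doublePair {k₁ l₁ k₂ l₂ : Fin p} (hk : k₁ ≠ k₂) (hl : l₁ ≠ l₂) :
    ¬ HomVanishing (doublePair k₁ l₁ k₂ l₂) := by
  have hmem := mem_part_doublePair hk hl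
  rintro ⟨k, h⟩
  refine absurd h (not_le.2 ?_)
  fin_cases k
  · refine card_lt_of_two_missing hk ?_ ?_ <;>
    simp only [Finset.mem_filter, Finset.mem_univ, true_and]
    · exact singleton_notMem_of_mem_part (b := (1, l₁)) ((hmem _ _).2 (by simp)) (by simp)
    · exact singleton_notMem_of_mem_part (b := (1, l₂)) ((hmem _ _).2 (by simp)) (by simp)
  · refine card_lt_of_two_missing hl ?_ ?_ <;>
    simp only [Finset.mem_filter, Finset.mem_univ, true_and]
    · exact singleton_notMem_of_mem_part (b := (0, k₁)) ((hmem _ _).2 (by simp)) (by simp)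
    · exact singleton_notMem_of_mem_part (b := (0, k₂)) ((hmem _ _).2 (by simp)) (by simp)

lemma eq_of_card_le_two {α : Type*} [DecidableEq α] {s : Finset α} (hs : s.card ≤ 2) {a b c : α}
    (ha : a ∈ s) (hb : b ∈ s) (hc : c ∈ s) (hab : a ≠ b) : c = a ∨ c = b := by
  by_contra! h
  have : ({a, b, c} : Finset α) ⊆ s := by
    intro x hx
    simp only [Finset.mem_insert, Finset.mem_singleton] at hx
    rcases hx with rfl | rfl | rfl <;> assumption
  have := Finset.card_le_card this
  rw [Finset.card_eq_three.2 ⟨a, b, c, hab, h.1.symm, h.2.symm, rfl⟩] at this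
  omega

/-- The extremal partitions of two rows having a part that meets both rows. -/
lemma exists_eq_doublePair {π : SetPart 2 p} (h : ¬ HomVanishing π)
    (hcard : π.parts.card = (p - 1) * 2) {k₁ l₁ : Fin p} (h₁ : (1, l₁) ∈ π.part (0, k₁)) :
    ∃ k₂ l₂, k₁ ≠ k₂ ∧ l₁ ≠ l₂ ∧ π = doublePair k₁ l₁ k₂ l₂ := by
  obtain ⟨hle, hrow, -⟩ := extremal_structure h hcard
  have hsymm : ∀ {a b}, b ∈ π.part a → a ∈ π.part b := fun {a b} hab => by
    rw [← label_eq_label_iff] at hab ⊢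
    exact hab.symm
  have hle' : ∀ a, (π.part a).card ≤ 2 := fun a => hle _ (π.part_mem.2 (Finset.mem_univ a))
  -- Exactly two positions of each row are not singletons. One of each row is used by the given
  -- cross pair, so it remains to locate the other two.
  have hN : ∀ k, (Finset.univ.filter fun l : Fin p => {(k, l)} ∉ π.parts).card = 2 := by
    intro k
    have h1 := hrow k
    have h2 := Finset.card_filter_add_card_filter_not (s := (Finset.univ : Finset (Fin p)))
      (fun l => {(k, l)} ∈ π.parts)
    rw [Finset.card_univ, Fintype.card_fin] at h2
    unfold rowSingletons at h1
    omega
  have hN3 : ∀ k a b c, {(k, a)} ∉ π.parts → {(k, b)} ∉ π.parts → {(k, c)} ∉ π.parts → a ≠ b →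
      c = a ∨ c = b := fun k a b c ha hb hc hab =>
    eq_of_card_le_two (hN k).le (by simpa using ha) (by simpa using hb) (by simpa using hc) hab
  have hk₁ : {((0 : Fin 2), k₁)} ∉ π.parts := singleton_notMem_of_mem_part h₁ (by simp)
  have hl₁ : {((1 : Fin 2), l₁)} ∉ π.parts := singleton_notMem_of_mem_part (hsymm h₁) (by simp)
  obtain ⟨k₂, hk₂, hk⟩ : ∃ k₂, {((0 : Fin 2), k₂)} ∉ π.parts ∧ k₂ ≠ k₁ := by
    have h1 : 1 < (Finset.univ.filter fun l : Fin p => {((0 : Fin 2), l)} ∉ π.parts).card := by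
      rw [hN]
      norm_num
    obtain ⟨k₂, h2, h3⟩ := Finset.exists_mem_ne h1 k₁
    exact ⟨k₂, (Finset.mem_filter.1 h2).2, h3⟩
  obtain ⟨b, hb, hbk⟩ : ∃ b ∈ π.part (0, k₂), b ≠ (0, k₂) := by
    by_contra! hcon
    refine hk₂ (part_eq_singleton_iff.2 ?_)
    ext b
    rw [Finset.mem_singleton]
    exact ⟨hcon b, fun hb => by rw [hb]; simp⟩
  have hself : ∀ a, a ∈ π.part a := fun a => by simp
  have htrans : ∀ {a b c}, b ∈ π.part a → c ∈ π.part b → c ∈ π.part a := fun {a b c} h1 h2 => by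
    rw [← label_eq_label_iff] at h1 h2 ⊢
    exact h1.trans h2
  have h3 : ∀ a b c d, b ∈ π.part a → c ∈ π.part a → d ∈ π.part a → b ≠ c → d = b ∨ d = c :=
    fun a b c d hb hc hd hbc => eq_of_card_le_two (hle' a) hb hc hd hbc
  have hk21 : (0, k₂) ∉ π.part (0, k₁) := by
    intro hmem
    rcases h3 _ _ _ _ (hself (0, k₁)) h₁ hmem (by simp) with h | h
    · exact hk (Prod.ext_iff.1 h).2
    · simp at h
  -- A partner of `(0, k₂)` in the first row could only be `(0, k₁)`, whose part is already filled
  -- by `(1, l₁)`.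
  obtain ⟨l₂, rfl⟩ : ∃ l₂, b = (1, l₂) := by
    obtain ⟨b₁, b₂⟩ := b
    fin_cases b₁
    · exfalso
      have hb₂ : {((0 : Fin 2), b₂)} ∉ π.parts :=
        singleton_notMem_of_mem_part (hsymm hb) hbk.symm
      rcases hN3 0 k₁ k₂ b₂ hk₁ hk₂ hb₂ hk.symm with rfl | rfl
      · exact hk21 (hsymm hb)
      · exact hbk rfl
    · exact ⟨b₂, rfl⟩
  have hl : l₁ ≠ l₂ := by
    rintro rfl
    exact hk21 (htrans h₁ (hsymm hb))
  have hl₂ : {((1 : Fin 2), l₂)} ∉ π.parts := singleton_notMem_of_mem_part (hsymm hb) (by simp)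
  refine ⟨k₂, l₂, hk.symm, hl, finpartition_ext_part fun a c => ?_⟩
  rw [mem_part_doublePair hk.symm hl]
  constructor
  · intro hac
    by_cases hac' : a = c
    · exact Or.inl hac'
    right
    have ha : {a} ∉ π.parts := singleton_notMem_of_mem_part hac (Ne.symm hac')
    have pair : ∀ {a b}, b ∈ π.part a → a ≠ b → c ∈ π.part a → a ≠ c → c = b :=
      fun {a b} hab hne hc hne' =>
        (h3 a a b c (hself a) hab hc hne).resolve_left (Ne.symm hne')
    obtain ⟨a₁, a₂⟩ := a
    fin_cases a₁
    · rcases hN3 0 k₁ k₂ a₂ hk₁ hk₂ ha hk.symm with rfl | rfl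
      · exact Or.inl ⟨rfl, pair h₁ (by simp) hac hac'⟩
      · exact Or.inr (Or.inr (Or.inl ⟨rfl, pair hb (by simp) hac hac'⟩))
    · rcases hN3 1 l₁ l₂ a₂ hl₁ hl₂ ha hl with rfl | rfl
      · exact Or.inr (Or.inl ⟨rfl, pair (hsymm h₁) (by simp) hac hac'⟩)
      · exact Or.inr (Or.inr (Or.inr ⟨rfl, pair (hsymm hb) (by simp) hac hac'⟩))
  · rintro (rfl | ⟨rfl, rfl⟩ | ⟨rfl, rfl⟩ | ⟨rfl, rfl⟩ | ⟨rfl, rfl⟩)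
    · exact hself a
    · exact h₁
    · exact hsymm h₁
    · exact hb
    · exact hsymm hb

end DoublePairs

/-! ### The combinatorial formula for the limiting variance -/

section SigmaHom

/-- Functions of disjoint sets of coordinates are uncorrelated under a product measure. -/
lemma integral_mul_of_disjoint_coordinates {X : Type*} [MeasurableSpace X] {μ : Measure X}
    [IsProbabilityMeasure μ] {ι : Type*} [Fintype ι] (q : ι → Prop) {F G : (ι → X) → ℝ}
    (hF : BddMeas F) (hG : BddMeas G)
    (hF' : ∀ x x' : ι → X, (∀ i, q i → x i = x' i) → F x = F x')
    (hG' : ∀ x x' : ι → X, (∀ i, ¬ q i → x i = x' i) → G x = G x') :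
    ∫ x, F x * G x ∂(Measure.pi fun _ => μ)
      = (∫ x, F x ∂(Measure.pi fun _ => μ)) * ∫ x, G x ∂(Measure.pi fun _ => μ) := by
  classical
  obtain ⟨x₀⟩ : Nonempty X := nonempty_of_isProbabilityMeasure μ
  let e := MeasurableEquiv.piEquivPiSubtypeProd (fun _ : ι => X) q
  have he := (measurePreserving_piEquivPiSubtypeProd (fun _ : ι => μ) q).symm
  have hval : ∀ (z : ({i // q i} → X) × ({i // ¬ q i} → X)) (i : ι),
      e.symm z i = if h : q i then z.1 ⟨i, h⟩ else z.2 ⟨i, h⟩ := fun z i => rfl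
  have hFz : ∀ z, F (e.symm z) = F (e.symm (z.1, fun _ => x₀)) := fun z =>
    hF' _ _ fun i hi => by rw [hval, hval, dif_pos hi, dif_pos hi]
  have hGz : ∀ z, G (e.symm z) = G (e.symm (fun _ => x₀, z.2)) := fun z =>
    hG' _ _ fun i hi => by rw [hval, hval, dif_neg hi, dif_neg hi]
  rw [← integral_comp_measurePreserving he hF.1, ← integral_comp_measurePreserving he hG.1,
    ← integral_comp_measurePreserving he (hF.mul hG).1]
  change ∫ z, F (e.symm z) * G (e.symm z) ∂_ = (∫ z, F (e.symm z) ∂_) * ∫ z, G (e.symm z) ∂_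
  simp_rw [hFz, hGz]
  rw [integral_prod_mul (fun a => F (e.symm (a, fun _ => x₀))) fun b => G (e.symm (fun _ => x₀, b)),
    integral_fun_fst (fun a => F (e.symm (a, fun _ => x₀))),
    integral_fun_snd fun b => G (e.symm (fun _ => x₀, b))]
  simp

variable {X : Type*} [MetricSpace X] [CompactSpace X] [MeasurableSpace X] [BorelSpace X]
  {μ : Measure X} [IsProbabilityMeasure μ] {p : ℕ}

lemma kappa_eq_zero_of_rows_disjoint (φ : C(Pairs p → ℝ, ℝ)) {π : SetPart 2 p}
    (h : ∀ k l, (1, l) ∉ π.part (0, k)) : kappa μ φ π = 0 := by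
  rw [kappa, jointCumulant_two, sub_eq_zero]
  refine integral_mul_of_disjoint_coordinates (fun C => ∃ l, partLabel π (0, l) = C)
    (bddMeas_obs_comp φ _) (bddMeas_obs_comp φ _) ?_ ?_
  · intro x x' hx
    congr 2
    funext l
    exact hx _ ⟨l, rfl⟩
  · intro x x' hx
    congr 2
    funext l
    refine hx _ ?_
    rintro ⟨k, hk⟩
    exact h k l (label_eq_label_iff.1 hk)

/-- An extremal partition with no part meeting both rows makes the two factors independent and
contributes zero. The others are double pairs, and `k₁ < k₂` selects one of the two descriptions of
each. -/
lemma kappaSum_two_eq_sigmaHomSq (φ : C(Pairs p → ℝ, ℝ)) :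
    kappaSum μ φ 2 = sigmaHomSq μ φ := by
  classical
  have hs : sigmaHomSq μ φ = ∑ d : Fin p × Fin p × Fin p × Fin p with
      d.1 < d.2.1 ∧ d.2.2.1 ≠ d.2.2.2, kappa μ φ (doublePair d.1 d.2.2.1 d.2.1 d.2.2.2) := by
    rw [Finset.sum_filter, Fintype.sum_prod_type]
    simp_rw [Fintype.sum_prod_type]
    rfl
  rw [hs, kappaSum, ← Finset.sum_filter]
  symm
  refine Finset.sum_of_injOn
    (fun d : Fin p × Fin p × Fin p × Fin p => doublePair d.1 d.2.2.1 d.2.1 d.2.2.2) ?_ ?_ ?_ ?_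
  · rintro ⟨k₁, k₂, l₁, l₂⟩ hd ⟨k₁', k₂', l₁', l₂'⟩ hd' heq
    simp only [Finset.coe_filter, Finset.mem_univ, true_and, Set.mem_ofPred_eq] at hd hd' heq
    -- Reading off the parts that cross the rows recovers the unordered set of the two pairs; the
    -- order of the `k`'s then fixes the labelling.
    have key : ∀ k l, ((k = k₁ ∧ l = l₁) ∨ (k = k₂ ∧ l = l₂))
        ↔ ((k = k₁' ∧ l = l₁') ∨ (k = k₂' ∧ l = l₂')) := by
      intro k l
      have h1 := mem_part_doublePair hd.1.ne hd.2 (0, k) (1, l)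
      have h2 := mem_part_doublePair hd'.1.ne hd'.2 (0, k) (1, l)
      rw [heq] at h1
      simpa using h1.symm.trans h2
    have a1 := (key k₁ l₁).1 (Or.inl ⟨rfl, rfl⟩)
    have a2 := (key k₂ l₂).1 (Or.inr ⟨rfl, rfl⟩)
    simp only [Prod.mk.injEq]
    have b1 := hd.1
    have b2 := hd'.1
    rcases a1 with ⟨rfl, rfl⟩ | ⟨rfl, rfl⟩ <;> rcases a2 with ⟨rfl, rfl⟩ | ⟨rfl, rfl⟩
    · exact absurd b1 (lt_irrefl _)
    · exact ⟨rfl, rfl, rfl, rfl⟩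
    · exact absurd b1 (not_lt.2 b2.le)
    · exact absurd b1 (lt_irrefl _)
  · rintro ⟨k₁, k₂, l₁, l₂⟩ hd
    simp only [Finset.coe_filter, Finset.mem_univ, true_and, Set.mem_ofPred_eq] at hd ⊢
    exact ⟨card_parts_doublePair hd.2, not_homVanishing_doublePair hd.1.ne hd.2⟩
  · intro π hπ hnot
    obtain ⟨-, hcard, hHV⟩ := Finset.mem_filter.1 hπ
    refine kappa_eq_zero_of_rows_disjoint φ fun k₁ l₁ hmem => hnot ?_
    obtain ⟨k₂, l₂, hk, hl, rfl⟩ := exists_eq_doublePair hHV hcard hmem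
    rcases lt_or_gt_of_ne hk with hlt | hgt
    · exact ⟨(k₁, k₂, l₁, l₂), by simp [hlt, hl], rfl⟩
    · exact ⟨(k₂, k₁, l₂, l₁), by simp [hgt, hl.symm], (doublePair_swap hk hl).symm⟩
  · intro d _
    rfl

end SigmaHom

/-! ### Leading order of sums of falling factorials -/

section Limits

lemma tendsto_descFactorial_div_pow {l m : ℕ} (h : l ≤ m) :
    Tendsto (fun n : ℕ => (n.descFactorial l : ℝ) / (n : ℝ) ^ m) atTop
      (𝓝 (if l = m then 1 else 0)) := by
  have h1 : Tendsto (fun n : ℕ => (n.descFactorial l : ℝ) / (n : ℝ) ^ l) atTop (𝓝 1) := by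
    have := isEquivalent_descFactorial l
    refine (isEquivalent_iff_tendsto_one ?_).1 this
    filter_upwards [eventually_ge_atTop 1] with n hn
    have : (0 : ℝ) < n := by exact_mod_cast hn
    positivity
  split_ifs with hlm
  · rw [← hlm]
    exact h1
  · have h2 : Tendsto (fun n : ℕ => ((n : ℝ)⁻¹) ^ (m - l)) atTop (𝓝 0) := by
      have := (tendsto_inv_atTop_nhds_zero_nat (𝕜 := ℝ)).pow (m - l)
      rwa [zero_pow (by omega)] at this
    have h3 := h1.mul h2
    rw [mul_zero] at h3
    refine h3.congr' ?_
    filter_upwards [eventually_ge_atTop 1] with n hn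
    have hn0 : (n : ℝ) ≠ 0 := by
      have : (0 : ℝ) < n := by exact_mod_cast hn
      exact this.ne'
    rw [inv_pow, ← div_eq_mul_inv, div_div, ← pow_add, Nat.add_sub_cancel' h]

-- Once the vanishing partitions are discarded, the number of parts is at most `(p-1)r`, and only
-- those attaining the bound survive division by `n^((p-1)r)`.
open Classical in
lemma tendsto_sum_descFactorial {r p : ℕ} (g : SetPart r p → ℝ)
    (hg : ∀ π, HomVanishing π → g π = 0) :
    Tendsto (fun n : ℕ => (∑ π : SetPart r p, (n.descFactorial π.parts.card : ℝ) * g π)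
        / (n : ℝ) ^ ((p - 1) * r)) atTop
      (𝓝 (∑ π : SetPart r p,
        if π.parts.card = (p - 1) * r ∧ ¬ HomVanishing π then g π else 0)) := by
  simp_rw [Finset.sum_div]
  refine tendsto_finsetSum _ fun π _ => ?_
  by_cases hπ : HomVanishing π
  · simp [hπ, hg π hπ]
  · simp only [hπ, not_false_eq_true, and_true]
    have := (tendsto_descFactorial_div_pow (card_parts_le_of_not_homVanishing hπ)).mul_const (g π)
    refine (this.congr fun n => by ring).trans_eq ?_
    split_ifs <;> simp

/-- The second coefficient of the falling factorial of degree `p + 1` is `-(1 + ⋯ + p)`. -/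
lemma tendsto_pow_sub_descPochhammer (p : ℕ) :
    Tendsto (fun n : ℕ => ((n : ℝ) ^ (p + 1) - (n.descFactorial (p + 1) : ℝ)) / (n : ℝ) ^ p) atTop
      (𝓝 ((p + 1).choose 2 : ℝ)) := by
  simp_rw [← descPochhammer_eval_eq_descFactorial]
  induction p with
  | zero => simp
  | succ p ih =>
    have h1 := (tendsto_descFactorial_div_pow (le_refl (p + 1))).const_mul ((p + 1 : ℕ) : ℝ)
    simp only [if_true, mul_one] at h1
    have h2 := ih.add h1
    have h3 : (((p + 1 + 1).choose 2 : ℕ) : ℝ) = ((p + 1).choose 2 : ℕ) + ((p + 1 : ℕ) : ℝ) := by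
      rw [Nat.choose_succ_succ' (p + 1) 1, Nat.choose_one_right]
      push_cast
      ring
    rw [h3]
    refine h2.congr' ?_
    filter_upwards [eventually_ge_atTop 1] with n hn
    have hn0 : (n : ℝ) ≠ 0 := by
      have : (0 : ℝ) < n := by exact_mod_cast hn
      exact this.ne'
    rw [← descPochhammer_eval_eq_descFactorial, descPochhammer_succ_eval (p + 1)]
    field_simp
    ring

/-- In a single row, once all positions but one are singletons, the last one has nothing left to be
joined with. -/
lemma homVanishing_one_row_iff {p : ℕ} (hp : 1 ≤ p) (π : SetPart 1 p) :
    HomVanishing π ↔ π = ⊥ := by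
  have hbot : ∀ q : Fin 1 × Fin p, {q} ∈ (⊥ : SetPart 1 p).parts := fun q =>
    Finpartition.mem_bot_iff.2 ⟨q, Finset.mem_univ _, rfl⟩
  constructor
  · intro h
    obtain ⟨k, l₀, hk⟩ := h.exists_free_row hp
    have hone : ∀ a b : Fin 1 × Fin p, b ∈ π.part a → a = b := by
      intro a b hab
      by_contra hne
      have h1 : ∀ q : Fin 1 × Fin p, q.2 ≠ l₀ → {q} ∈ π.parts := fun q hq => by
        have := hk q.2 hq
        rwa [show (k, q.2) = q from Prod.ext (Subsingleton.elim _ _) rfl] at this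
      by_cases ha : a.2 = l₀
      · by_cases hb : b.2 = l₀
        · exact hne (Prod.ext (Subsingleton.elim _ _) (ha.trans hb.symm))
        · exact hne (eq_of_label_eq_of_singleton (h1 b hb) (label_eq_label_iff.2 hab).symm).symm
      · exact hne (eq_of_label_eq_of_singleton (h1 a ha) (label_eq_label_iff.2 hab))
    refine finpartition_ext_part fun a b => ?_
    rw [part_eq_singleton_iff.1 (hbot a), Finset.mem_singleton]
    exact ⟨fun h => (hone a b h).symm, fun h => by rw [h]; simp⟩
  · rintro rfl
    refine ⟨0, ?_⟩
    simp

open Classical in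
/-- The number of extremal partitions of a single row. -/
lemma card_extremal_one_row {p : ℕ} (hp : 1 ≤ p) :
    (∑ π : SetPart 1 p, if π.parts.card = (p - 1) * 1 ∧ ¬ HomVanishing π then (1 : ℝ) else 0)
      = (p.choose 2 : ℝ) := by
  obtain ⟨q, rfl⟩ : ∃ q, p = q + 1 := ⟨p - 1, by omega⟩
  -- The count is obtained from asymptotics: with weight `1` on the non-discrete partitions, the sum
  -- is the number of non-injective index families, `n^(q+1)` minus a falling factorial. Its
  -- coefficient at order `n^q` is computed in two ways.
  have h1 := tendsto_sum_descFactorial (r := 1) (p := q + 1)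
    (fun π => if HomVanishing π then 0 else 1) (fun π h => by simp [h])
  have h2 := tendsto_pow_sub_descPochhammer q
  have h3 : ∀ n : ℕ, (∑ π : SetPart 1 (q + 1), (n.descFactorial π.parts.card : ℝ) *
      (if HomVanishing π then 0 else 1)) = (n : ℝ) ^ (q + 1) - (n.descFactorial (q + 1) : ℝ) := by
    intro n
    have h4 := sum_comp_kerPart (α := Fin 1 × Fin (q + 1)) n fun _ => 1
    simp only [Finset.sum_const, Finset.card_univ, Fintype.card_fun, Fintype.card_prod,
      Fintype.card_fin, one_mul, nsmul_eq_mul, mul_one, Nat.cast_pow] at h4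
    rw [h4, ← Finset.add_sum_erase _ _ (Finset.mem_univ (⊥ : SetPart 1 (q + 1))),
      ← Finset.add_sum_erase Finset.univ (fun π : SetPart 1 (q + 1) =>
        (n.descFactorial π.parts.card : ℝ)) (Finset.mem_univ (⊥ : SetPart 1 (q + 1))),
      if_pos ((homVanishing_one_row_iff hp _).2 rfl)]
    simp only [Finpartition.card_bot, Finset.card_univ, Fintype.card_prod, Fintype.card_fin,
      one_mul, mul_zero, zero_add, add_sub_cancel_left]
    refine Finset.sum_congr rfl fun π hπ => ?_
    rw [if_neg fun h => Finset.ne_of_mem_erase hπ ((homVanishing_one_row_iff hp _).1 h), mul_one]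
  simp_rw [h3, Nat.add_sub_cancel, mul_one] at h1
  rw [← tendsto_nhds_unique h1 h2]
  refine Finset.sum_congr rfl fun π _ => ?_
  simp only [Nat.add_sub_cancel, mul_one]
  split_ifs with ha hb <;> simp_all

end Limits

/-! ### Moment determinacy and the method of moments -/

section MethodOfMoments

/-- The series of `cosh` has only nonnegative terms, so Tonelli applies and the moment bounds give a
convergent geometric series; then `exp ≤ 2 cosh`. Only even moments are needed. -/
lemma integrable_exp_mul_of_moments_le {ν : Measure ℝ} [IsProbabilityMeasure ν]
    (hinteg : ∀ k : ℕ, Integrable (fun x : ℝ => x ^ k) ν) {A C : ℝ}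
    (hbd : ∀ k : ℕ, |∫ x, x ^ k ∂ν| ≤ A * C ^ k * k.factorial) {t : ℝ} (ht : |t * C| < 1) :
    Integrable (fun x => Real.exp (t * x)) ν := by
  have hcosh : Integrable (fun x => Real.cosh (t * x)) ν := by
    refine ⟨by fun_prop, ?_⟩
    rw [hasFiniteIntegral_iff_ofReal (ae_of_all _ fun x => (Real.cosh_pos _).le)]
    have hnn : ∀ (x : ℝ) (m : ℕ), 0 ≤ (t * x) ^ (2 * m) / ((2 * m).factorial : ℝ) := fun x m =>
      div_nonneg (Even.pow_nonneg (even_two_mul m) _) (by positivity)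
    have h1 : ∀ x : ℝ, ENNReal.ofReal (Real.cosh (t * x))
        = ∑' m : ℕ, ENNReal.ofReal ((t * x) ^ (2 * m) / ((2 * m).factorial : ℝ)) := fun x => by
      rw [← (Real.hasSum_cosh (t * x)).tsum_eq]
      exact ENNReal.ofReal_tsum_of_nonneg (hnn x) (Real.hasSum_cosh (t * x)).summable
    simp_rw [h1]
    rw [lintegral_tsum fun m => by fun_prop]
    have h2 : ∀ m : ℕ, ∫⁻ x, ENNReal.ofReal ((t * x) ^ (2 * m) / ((2 * m).factorial : ℝ)) ∂ν
        ≤ ENNReal.ofReal (A * ((t * C) ^ 2) ^ m) := by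
      intro m
      have hi : Integrable (fun x : ℝ => (t * x) ^ (2 * m) / ((2 * m).factorial : ℝ)) ν := by
        simp_rw [mul_pow]
        exact ((hinteg (2 * m)).const_mul _).div_const _
      rw [← ofReal_integral_eq_lintegral_ofReal hi (ae_of_all _ fun x => hnn x m)]
      refine ENNReal.ofReal_le_ofReal ?_
      simp_rw [mul_pow t]
      rw [integral_div, integral_const_mul, div_le_iff₀ (by positivity)]
      have hb := (le_abs_self _).trans (hbd (2 * m))
      calc t ^ (2 * m) * ∫ x, x ^ (2 * m) ∂ν
          ≤ t ^ (2 * m) * (A * C ^ (2 * m) * (2 * m).factorial) :=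
            mul_le_mul_of_nonneg_left hb (Even.pow_nonneg (even_two_mul m) _)
        _ = A * (t ^ 2 * C ^ 2) ^ m * (2 * m).factorial := by
            rw [mul_pow, ← pow_mul, ← pow_mul]
            ring
    refine lt_of_le_of_lt (ENNReal.tsum_le_tsum h2) ?_
    have hs : Summable fun m : ℕ => A * ((t * C) ^ 2) ^ m := by
      refine (summable_geometric_of_lt_one (sq_nonneg _) ?_).mul_left A
      rw [← sq_abs]
      exact pow_lt_one₀ (abs_nonneg _) ht (by norm_num)
    exact hs.tsum_ofReal_lt_top
  refine (hcosh.const_mul 2).mono' (by fun_prop) (ae_of_all _ fun x => ?_)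
  rw [Real.norm_of_nonneg (Real.exp_pos _).le, Real.cosh_eq]
  have := Real.exp_pos (-(t * x))
  linarith

lemma zero_mem_interior_integrableExpSet_of_moments_le {ν : Measure ℝ} [IsProbabilityMeasure ν]
    (hinteg : ∀ k : ℕ, Integrable (fun x : ℝ => x ^ k) ν) {A C : ℝ}
    (hbd : ∀ k : ℕ, |∫ x, x ^ k ∂ν| ≤ A * C ^ k * k.factorial) :
    0 ∈ interior (integrableExpSet (id : ℝ → ℝ) ν) := by
  rw [mem_interior]
  refine ⟨{t | |t * C| < 1}, fun t ht => integrable_exp_mul_of_moments_le hinteg hbd ht, ?_, ?_⟩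
  · exact isOpen_lt (by fun_prop) continuous_const
  · simp

/-- A law with exponential moments is determined by its moments. -/
lemma measure_eq_of_moments_eq {ν ν' : Measure ℝ} [IsProbabilityMeasure ν] [IsProbabilityMeasure ν']
    (hν : 0 ∈ interior (integrableExpSet (id : ℝ → ℝ) ν))
    (hν' : 0 ∈ interior (integrableExpSet (id : ℝ → ℝ) ν'))
    (h : ∀ k : ℕ, ∫ x, x ^ k ∂ν = ∫ x, x ^ k ∂ν') : ν = ν' := by
  -- A vertical strip around the imaginary axis on which both transforms are analytic. Their
  -- derivatives at `0` are the moments, so they agree near `0`, then on the whole strip, and in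
  -- particular on the axis, where they are the characteristic functions.
  set U : Set ℂ := {z | z.re ∈ interior (integrableExpSet (id : ℝ → ℝ) ν)
    ∩ interior (integrableExpSet (id : ℝ → ℝ) ν')} with hU
  have hf : AnalyticOnNhd ℂ (complexMGF id ν) U := fun z hz => analyticAt_complexMGF hz.1
  have hg : AnalyticOnNhd ℂ (complexMGF id ν') U := fun z hz => analyticAt_complexMGF hz.2
  have h0 : (0 : ℂ) ∈ U := ⟨by simpa using hν, by simpa using hν'⟩
  have hder : ∀ n, iteratedDeriv n (complexMGF id ν) 0 = iteratedDeriv n (complexMGF id ν') 0 := by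
    intro n
    rw [iteratedDeriv_complexMGF h0.1, iteratedDeriv_complexMGF h0.2]
    simp only [id_eq, zero_mul, Complex.exp_zero, mul_one]
    simp_rw [← Complex.ofReal_pow]
    rw [integral_complex_ofReal, integral_complex_ofReal, h]
  have hev : complexMGF id ν =ᶠ[𝓝 0] complexMGF id ν' := by
    have hpf := (hf 0 h0).hasFPowerSeriesAt.eventually_hasSum
    have hpg := (hg 0 h0).hasFPowerSeriesAt.eventually_hasSum
    simp_rw [hder] at hpf
    filter_upwards [hpf, hpg] with z h1 h2
    simpa using h1.unique h2
  have hconv : IsPreconnected U :=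
    ((convex_integrableExpSet.interior.inter convex_integrableExpSet.interior).linear_preimage
      Complex.reLm).isPreconnected
  have heq := hf.eqOn_of_preconnected_of_eventuallyEq hg hconv h0 hev
  refine Measure.ext_of_charFun ?_
  funext t
  rw [← complexMGF_id_mul_I, ← complexMGF_id_mul_I]
  have ht : (t * Complex.I : ℂ) ∈ U := ⟨by simpa using hν, by simpa using hν'⟩
  exact heq ht

/-- Truncation of a real number to the interval `[-K, K]`. -/
def trunc (K x : ℝ) : ℝ := max (-K) (min K x)

lemma continuous_trunc (K : ℝ) : Continuous (trunc K) := by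
  unfold trunc
  fun_prop

lemma abs_trunc_le {K : ℝ} (hK : 0 ≤ K) (x : ℝ) : |trunc K x| ≤ K := by
  unfold trunc
  rw [abs_le]
  exact ⟨le_max_left _ _, max_le (by linarith) (min_le_left _ _)⟩

lemma abs_trunc_le_abs {K : ℝ} (hK : 0 ≤ K) (x : ℝ) : |trunc K x| ≤ |x| := by
  unfold trunc
  rcases abs_cases x with ⟨h1, h2⟩ | ⟨h1, h2⟩ <;> rw [h1, abs_le] <;>
  constructor
  · exact le_trans (by linarith) (le_max_right _ _ |>.trans' (le_min hK h2))
  · exact max_le (by linarith) (min_le_right _ _)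
  · exact le_max_of_le_right (le_min (by linarith) (by linarith))
  · exact max_le (by linarith) ((min_le_right _ _).trans (by linarith))

lemma trunc_eq_self {K x : ℝ} (h : |x| ≤ K) : trunc K x = x := by
  obtain ⟨h1, h2⟩ := abs_le.1 h
  rw [trunc, min_eq_right h2, max_eq_right h1]

/-- The truncated power, as a bounded continuous function. -/
def truncPow (K : ℝ) (hK : 0 ≤ K) (k : ℕ) : BoundedContinuousFunction ℝ ℝ :=
  BoundedContinuousFunction.ofNormedAddCommGroup (fun x => trunc K x ^ k)
    ((continuous_trunc K).pow k) (K ^ k) fun x => by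
      rw [norm_pow]
      exact pow_le_pow_left₀ (norm_nonneg _) (abs_trunc_le hK x) k

/-- The difference is nonzero only when `|x| > K`, where it is at most `2|x|^k` and `|x|^k ≥ K`. The
next even moment then controls the truncation error uniformly. -/
lemma abs_pow_sub_trunc_pow_le {K : ℝ} (hK : 1 ≤ K) {k : ℕ} (hk : k ≠ 0) (x : ℝ) :
    |x ^ k - trunc K x ^ k| ≤ 2 / K * x ^ (2 * k) := by
  have hK0 : 0 < K := by linarith
  have hnn : 0 ≤ x ^ (2 * k) := Even.pow_nonneg (even_two_mul k) _
  by_cases h : |x| ≤ K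
  · rw [trunc_eq_self h, sub_self, abs_zero]
    positivity
  · push Not at h
    have h1 : |x ^ k - trunc K x ^ k| ≤ 2 * |x| ^ k := by
      refine (abs_sub _ _).trans ?_
      rw [abs_pow, abs_pow, two_mul]
      exact add_le_add le_rfl (pow_le_pow_left₀ (abs_nonneg _) (abs_trunc_le_abs hK0.le x) k)
    have h2 : K ≤ |x| ^ k := by
      calc K ≤ |x| := h.le
        _ ≤ |x| ^ k := le_self_pow₀ (by linarith) hk
    refine h1.trans ?_
    rw [show x ^ (2 * k) = |x| ^ k * |x| ^ k by
      rw [mul_comm, pow_mul, ← abs_pow, ← sq, sq_abs], div_mul_eq_mul_div, le_div_iff₀ hK0]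
    have : 0 ≤ |x| ^ k := by positivity
    nlinarith

lemma abs_integral_pow_sub_truncPow_le {ν : Measure ℝ} [IsProbabilityMeasure ν]
    (hinteg : ∀ k : ℕ, Integrable (fun x : ℝ => x ^ k) ν) {K : ℝ} (hK : 1 ≤ K)
    {k : ℕ} (hk : k ≠ 0) :
    |∫ x, x ^ k ∂ν - ∫ x, truncPow K (by linarith) k x ∂ν| ≤ 2 / K * ∫ x, x ^ (2 * k) ∂ν := by
  rw [← integral_sub (hinteg k) (BoundedContinuousFunction.integrable ν _), ← integral_const_mul]
  refine (abs_integral_le_integral_abs).trans (integral_mono ?_ ((hinteg _).const_mul _) ?_)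
  · exact ((hinteg k).sub (BoundedContinuousFunction.integrable ν _)).abs
  · exact fun x => abs_pow_sub_trunc_pow_le hK hk x

/-- Weak limits inherit the limits of the moments. -/
lemma moments_of_tendsto {ι : Type*} {l : Filter ι} [l.NeBot] {ν : ι → ProbabilityMeasure ℝ}
    {ν' : ProbabilityMeasure ℝ} (hν : Tendsto ν l (𝓝 ν'))
    (hinteg : ∀ i (k : ℕ), Integrable (fun x : ℝ => x ^ k) (ν i : Measure ℝ)) {m : ℕ → ℝ}
    (hm : ∀ k, Tendsto (fun i => ∫ x, x ^ k ∂(ν i : Measure ℝ)) l (𝓝 (m k))) :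
    (∀ k : ℕ, Integrable (fun x : ℝ => x ^ k) (ν' : Measure ℝ)) ∧
      ∀ k : ℕ, ∫ x, x ^ k ∂(ν' : Measure ℝ) = m k := by
  rw [ProbabilityMeasure.tendsto_iff_forall_integral_tendsto] at hν
  have htr : ∀ (K : ℝ) (hK : 0 ≤ K) (k : ℕ),
      ∫ x, truncPow K hK (2 * k) x ∂(ν' : Measure ℝ) ≤ m (2 * k) := by
    intro K hK k
    refine le_of_tendsto_of_tendsto' (hν _) (hm _) fun i => ?_
    refine integral_mono (BoundedContinuousFunction.integrable _ _) (hinteg i _) fun x => ?_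
    change trunc K x ^ (2 * k) ≤ x ^ (2 * k)
    rw [pow_mul, pow_mul, ← sq_abs, ← sq_abs x]
    exact pow_le_pow_left₀ (sq_nonneg _)
      (pow_le_pow_left₀ (abs_nonneg _) (abs_trunc_le_abs hK x) 2) k
  have hnn : ∀ (k : ℕ) (x : ℝ), 0 ≤ x ^ (2 * k) := fun k x => Even.pow_nonneg (even_two_mul k) _
  -- Fatou's lemma along the truncations at integer levels: integrability under the limit law is not
  -- known beforehand.
  have hlint : ∀ k : ℕ, ∫⁻ x, ENNReal.ofReal (x ^ (2 * k)) ∂(ν' : Measure ℝ)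
      ≤ ENNReal.ofReal (m (2 * k)) := by
    intro k
    have hlim : ∀ x : ℝ, Tendsto (fun n : ℕ => ENNReal.ofReal (trunc n x ^ (2 * k))) atTop
        (𝓝 (ENNReal.ofReal (x ^ (2 * k)))) := by
      intro x
      refine tendsto_const_nhds.congr' ?_
      obtain ⟨N, hN⟩ := exists_nat_ge |x|
      filter_upwards [eventually_ge_atTop N] with n hn
      rw [trunc_eq_self (hN.trans (by exact_mod_cast hn))]
    have hmeas : ∀ n : ℕ, Measurable fun x => ENNReal.ofReal (trunc n x ^ (2 * k)) := fun n =>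
      (((continuous_trunc n).pow _).measurable).ennreal_ofReal
    calc ∫⁻ x, ENNReal.ofReal (x ^ (2 * k)) ∂(ν' : Measure ℝ)
        = ∫⁻ x, liminf (fun n : ℕ => ENNReal.ofReal (trunc n x ^ (2 * k))) atTop
            ∂(ν' : Measure ℝ) := by
          congr 1
          funext x
          exact (hlim x).liminf_eq.symm
      _ ≤ liminf (fun n : ℕ => ∫⁻ x, ENNReal.ofReal (trunc n x ^ (2 * k)) ∂(ν' : Measure ℝ))
            atTop := lintegral_liminf_le hmeas
      _ ≤ ENNReal.ofReal (m (2 * k)) := by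
          refine liminf_le_of_le (by isBoundedDefault) fun b hb => ?_
          obtain ⟨n, hn⟩ := hb.exists
          refine hn.trans ?_
          have hi := BoundedContinuousFunction.integrable (ν' : Measure ℝ)
            (truncPow n n.cast_nonneg (2 * k))
          have := ofReal_integral_eq_lintegral_ofReal hi (ae_of_all _ fun x => hnn k (trunc n x))
          exact this.symm.le.trans (ENNReal.ofReal_le_ofReal (htr n n.cast_nonneg k))
  have hinteg2 : ∀ k : ℕ, Integrable (fun x : ℝ => x ^ (2 * k)) (ν' : Measure ℝ) := fun k =>
    ⟨by fun_prop, (hasFiniteIntegral_iff_ofReal (ae_of_all _ (hnn k))).2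
      ((hlint k).trans_lt ENNReal.ofReal_lt_top)⟩
  have hinteg' : ∀ k : ℕ, Integrable (fun x : ℝ => x ^ k) (ν' : Measure ℝ) := by
    intro k
    refine ((integrable_const (1 : ℝ)).add (hinteg2 k)).mono' (by fun_prop)
      (ae_of_all _ fun x => ?_)
    simp only [Pi.add_apply, Real.norm_eq_abs]
    rw [mul_comm 2 k, pow_mul, ← sq_abs]
    nlinarith [sq_nonneg (|x ^ k| - 1), abs_nonneg (x ^ k)]
  refine ⟨hinteg', fun k => ?_⟩
  rcases eq_or_ne k 0 with rfl | hk
  · refine tendsto_nhds_unique ?_ (hm 0)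
    simp
  have hm2 : ∫ x, x ^ (2 * k) ∂(ν' : Measure ℝ) ≤ m (2 * k) := by
    have h1 := hlint k
    rw [← ofReal_integral_eq_lintegral_ofReal (hinteg2 k) (ae_of_all _ (hnn k))] at h1
    refine (ENNReal.ofReal_le_ofReal_iff ?_).1 h1
    exact ge_of_tendsto' (hm (2 * k)) fun i => integral_nonneg (hnn k)
  -- Truncation at level `K` costs `2 m(2k) / K` under the limit law and as much in the limit along
  -- the sequence; the truncated integrals themselves converge.
  have hbound : ∀ K : ℝ, 1 ≤ K → |∫ x, x ^ k ∂(ν' : Measure ℝ) - m k| ≤ 4 * m (2 * k) / K := by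
    intro K hK
    have hK0 : 0 < K := by linarith
    have h1 := abs_integral_pow_sub_truncPow_le hinteg' hK hk
    have h2 : |m k - ∫ x, truncPow K (by linarith) k x ∂(ν' : Measure ℝ)| ≤ 2 / K * m (2 * k) :=
      le_of_tendsto_of_tendsto' ((hm k).sub (hν _)).abs ((hm (2 * k)).const_mul _)
        fun i => abs_integral_pow_sub_truncPow_le (hinteg i) hK hk
    have h3 : 2 / K * ∫ x, x ^ (2 * k) ∂(ν' : Measure ℝ) ≤ 2 / K * m (2 * k) := by gcongr
    have h4 : 4 * m (2 * k) / K = 2 / K * m (2 * k) + 2 / K * m (2 * k) := by ring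
    rw [h4]
    rw [abs_le] at h1 h2 ⊢
    constructor <;> linarith [h1.1, h1.2, h2.1, h2.2]
  have hz : |∫ x, x ^ k ∂(ν' : Measure ℝ) - m k| ≤ 0 := by
    refine ge_of_tendsto (tendsto_const_nhds.div_atTop tendsto_id :
      Tendsto (fun K : ℝ => 4 * m (2 * k) / K) atTop (𝓝 0)) ?_
    filter_upwards [eventually_ge_atTop (1 : ℝ)] with K hK using hbound K hK
  exact sub_eq_zero.1 (abs_nonpos_iff.1 hz)

/-- Markov's inequality for `x²`. -/
lemma isTightMeasureSet_of_second_moment_le {S : Set (ProbabilityMeasure ℝ)} {B : ℝ}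
    (hinteg : ∀ ν ∈ S, Integrable (fun x : ℝ => x ^ 2) (ν : Measure ℝ))
    (hB : ∀ ν ∈ S, ∫ x, x ^ 2 ∂(ν : Measure ℝ) ≤ B) :
    IsTightMeasureSet {((ν : ProbabilityMeasure ℝ) : Measure ℝ) | ν ∈ S} := by
  refine isTightMeasureSet_of_tendsto_measure_norm_gt ?_
  have hlim : Tendsto (fun r : ℝ => ENNReal.ofReal (B / r ^ 2)) atTop (𝓝 0) := by
    rw [← ENNReal.ofReal_zero]
    exact ENNReal.tendsto_ofReal
      (tendsto_const_nhds.div_atTop (tendsto_pow_atTop (by norm_num : (2 : ℕ) ≠ 0)))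
  refine tendsto_of_tendsto_of_tendsto_of_le_of_le' tendsto_const_nhds hlim
    (Eventually.of_forall fun _ => zero_le) ?_
  filter_upwards [eventually_gt_atTop (0 : ℝ)] with r hr
  refine iSup₂_le ?_
  rintro _ ⟨ν, hν, rfl⟩
  have hsub : {x : ℝ | r < ‖x‖} ⊆ {x | r ^ 2 ≤ x ^ 2} := by
    intro x hx
    rw [Set.mem_ofPred_eq, ← sq_abs x]
    exact pow_le_pow_left₀ hr.le (le_of_lt hx) 2
  have h1 := mul_meas_ge_le_integral_of_nonneg (ae_of_all _ fun x : ℝ => sq_nonneg x)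
    (hinteg ν hν) (r ^ 2)
  have h2 : (ν : Measure ℝ).real {x | r ^ 2 ≤ x ^ 2} ≤ B / r ^ 2 := by
    rw [le_div_iff₀ (by positivity), mul_comm]
    exact h1.trans (hB ν hν)
  calc (ν : Measure ℝ) {x : ℝ | r < ‖x‖} ≤ (ν : Measure ℝ) {x | r ^ 2 ≤ x ^ 2} := measure_mono hsub
    _ = ENNReal.ofReal ((ν : Measure ℝ).real {x | r ^ 2 ≤ x ^ 2}) := by simp
    _ ≤ _ := ENNReal.ofReal_le_ofReal h2

/-- The method of moments. -/
theorem exists_tendsto_of_moments_tendsto {ν : ℕ → ProbabilityMeasure ℝ}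
    (hinteg : ∀ i (k : ℕ), Integrable (fun x : ℝ => x ^ k) (ν i : Measure ℝ)) {m : ℕ → ℝ}
    (hm : ∀ k, Tendsto (fun i => ∫ x, x ^ k ∂(ν i : Measure ℝ)) atTop (𝓝 (m k))) {A C : ℝ}
    (hbd : ∀ k, |m k| ≤ A * C ^ k * k.factorial) :
    ∃ ν' : ProbabilityMeasure ℝ, Tendsto ν atTop (𝓝 ν') ∧
      0 ∈ interior (integrableExpSet (id : ℝ → ℝ) (ν' : Measure ℝ)) ∧
      (∀ k : ℕ, ∫ x, x ^ k ∂(ν' : Measure ℝ) = m k) ∧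
      ∀ ρ : Measure ℝ, IsProbabilityMeasure ρ → (∀ k : ℕ, Integrable (fun x : ℝ => x ^ k) ρ) →
        (∀ k : ℕ, ∫ x, x ^ k ∂ρ = m k) → ρ = ν' := by
  have hexp : ∀ ρ : Measure ℝ, IsProbabilityMeasure ρ →
      (∀ k : ℕ, Integrable (fun x : ℝ => x ^ k) ρ) → (∀ k : ℕ, ∫ x, x ^ k ∂ρ = m k) →
      0 ∈ interior (integrableExpSet (id : ℝ → ℝ) ρ) := fun ρ _ hi hρ =>
    zero_mem_interior_integrableExpSet_of_moments_le hi fun k => by rw [hρ]; exact hbd k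
  have huniq : ∀ ρ ρ' : Measure ℝ, IsProbabilityMeasure ρ → IsProbabilityMeasure ρ' →
      (∀ k : ℕ, Integrable (fun x : ℝ => x ^ k) ρ) →
      (∀ k : ℕ, Integrable (fun x : ℝ => x ^ k) ρ') → (∀ k : ℕ, ∫ x, x ^ k ∂ρ = m k) →
      (∀ k : ℕ, ∫ x, x ^ k ∂ρ' = m k) → ρ = ρ' := fun ρ ρ' h1 h2 hi hi' hρ hρ' =>
    measure_eq_of_moments_eq (hexp ρ h1 hi hρ) (hexp ρ' h2 hi' hρ') fun k =>
      (hρ k).trans (hρ' k).symm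
  obtain ⟨B, hB⟩ := (hm 2).bddAbove_range
  have htight : IsTightMeasureSet
      {((ρ : ProbabilityMeasure ℝ) : Measure ℝ) | ρ ∈ Set.range ν} := by
    refine isTightMeasureSet_of_second_moment_le (B := B) ?_ ?_
    · rintro _ ⟨i, rfl⟩
      exact hinteg i 2
    · rintro _ ⟨i, rfl⟩
      exact hB ⟨i, rfl⟩
  have hcomp := isCompact_closure_of_isTightMeasureSet htight
  have hcl : ∀ i, ν i ∈ closure (Set.range ν) := fun i => subset_closure ⟨i, rfl⟩
  -- A cluster point is a limit along an ultrafilter, so it inherits the limit moments. Determinacy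
  -- leaves a single cluster point, and relative compactness then gives convergence.
  have hclus : ∀ ρ : ProbabilityMeasure ℝ, MapClusterPt ρ atTop ν →
      (∀ k : ℕ, Integrable (fun x : ℝ => x ^ k) (ρ : Measure ℝ)) ∧
        ∀ k : ℕ, ∫ x, x ^ k ∂(ρ : Measure ℝ) = m k := by
    intro ρ hρ
    obtain ⟨U, hU, hlim⟩ := mapClusterPt_iff_ultrafilter.1 hρ
    exact moments_of_tendsto hlim hinteg fun k => (hm k).mono_left hU
  obtain ⟨ν', -, hν'⟩ := hcomp.exists_mapClusterPt (f := atTop) (u := ν)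
    (tendsto_principal.2 (Eventually.of_forall hcl))
  obtain ⟨hi', hm'⟩ := hclus ν' hν'
  refine ⟨ν', ?_, hexp _ inferInstance hi' hm', hm', fun ρ h1 hi hρ =>
    huniq _ _ h1 inferInstance hi hi' hρ hm'⟩
  refine hcomp.tendsto_nhds_of_unique_mapClusterPt (Eventually.of_forall hcl) fun ρ _ hρ => ?_
  obtain ⟨hi, hm⟩ := hclus ρ hρ
  exact Subtype.ext (huniq _ _ ρ.2 ν'.2 hi hi' hm hm')

end MethodOfMoments

/-! ### Reduction to centred observables -/

section Centring

variable {X : Type*} [MetricSpace X] [CompactSpace X] [MeasurableSpace X] [BorelSpace X]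
  {μ : Measure X} [IsProbabilityMeasure μ] {p : ℕ}

/-- The observable `φ - Φ(μ)`. -/
def centred (μ : Measure X) (φ : C(Pairs p → ℝ, ℝ)) : C(Pairs p → ℝ, ℝ) :=
  φ + ContinuousMap.const _ (-polyObs φ μ)

lemma centred_apply (φ : C(Pairs p → ℝ, ℝ)) (v : Pairs p → ℝ) :
    centred μ φ v = φ v - polyObs φ μ := by
  simp [centred, sub_eq_add_neg]

lemma polyObs_centred (φ : C(Pairs p → ℝ, ℝ)) : polyObs (centred μ φ) μ = 0 := by
  rw [polyObs]
  simp_rw [centred_apply]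
  rw [integral_sub ((bddMeas_obs φ).integrable _) (integrable_const _), integral_const,
    probReal_univ, one_smul, ← polyObs, sub_self]

lemma sampleSum_centred (φ : C(Pairs p → ℝ, ℝ)) (x : ℕ → X) (n : ℕ) :
    sampleSum (centred μ φ) x n = sampleSum φ x n - (n : ℝ) ^ p * polyObs φ μ := by
  simp_rw [sampleSum, centred_apply]
  rw [Finset.sum_sub_distrib]
  simp

lemma kappa_centred (φ : C(Pairs p → ℝ, ℝ)) {r : ℕ} (hr : 2 ≤ r) (π : SetPart r p) :
    kappa μ (centred μ φ) π = kappa μ φ π :=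
  kappa_add_const hr φ _ π

lemma kappaSum_centred (φ : C(Pairs p → ℝ, ℝ)) {r : ℕ} (hr : 2 ≤ r) :
    kappaSum μ (centred μ φ) r = kappaSum μ φ r := by
  simp_rw [kappaSum, kappa_centred φ hr]

/-- A first cumulant is a mean and does feel the shift: each of the `p.choose 2` extremal partitions
of one row loses `Φ(μ)`. -/
lemma kappaSum_centred_one (hp : 1 ≤ p) (φ : C(Pairs p → ℝ, ℝ)) :
    kappaSum μ (centred μ φ) 1 = kappaSum μ φ 1 - (p.choose 2 : ℝ) * polyObs φ μ := by
  have hk : ∀ π : SetPart 1 p, kappa μ (centred μ φ) π = kappa μ φ π - polyObs φ μ := by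
    intro π
    rw [kappa, kappa, jointCumulant_one, jointCumulant_one]
    simp_rw [centred_apply]
    rw [integral_sub ((bddMeas_obs_comp φ _).integrable _) (integrable_const _), integral_const,
      probReal_univ, one_smul]
  rw [kappaSum, kappaSum, ← card_extremal_one_row hp, Finset.sum_mul, ← Finset.sum_sub_distrib]
  refine Finset.sum_congr rfl fun π _ => ?_
  split_ifs <;> simp [hk]

end Centring

/-! ### Limits of moments and cumulants of the centred sums -/

section LimitMoments

variable {X : Type*} [MetricSpace X] [CompactSpace X] [MeasurableSpace X] [BorelSpace X]
  {μ : Measure X} [IsProbabilityMeasure μ] {p : ℕ}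

open Classical in
/-- The limits of the moments of `S_n / n^(p-1)`, for a centred observable. -/
def limitMoment (μ : Measure X) (φ : C(Pairs p → ℝ, ℝ)) (r : ℕ) : ℝ :=
  ∑ π : SetPart r p,
    if π.parts.card = (p - 1) * r ∧ ¬ HomVanishing π then partMoment μ φ π else 0

lemma abs_partMoment_le {φ : C(Pairs p → ℝ, ℝ)} {B : ℝ}
    (hB : ∀ x : Fin p → X, |φ (distVec x)| ≤ B) {r : ℕ} (π : SetPart r p) :
    |partMoment μ φ π| ≤ B ^ r := by
  rw [partMoment, ← Real.norm_eq_abs]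
  refine (norm_integral_le_of_norm_le_const (C := B ^ r) (ae_of_all _ fun x => ?_)).trans ?_
  · rw [Real.norm_eq_abs, Finset.abs_prod]
    refine (Finset.prod_le_prod (fun _ _ => abs_nonneg _) fun k _ => hB _).trans ?_
    simp
  · simp

lemma exists_abs_limitMoment_le (μ : Measure X) [IsProbabilityMeasure μ]
    (φ : C(Pairs p → ℝ, ℝ)) :
    ∃ D : ℝ, ∀ r, |limitMoment μ φ r| ≤ D ^ r * r.factorial := by
  classical
  obtain ⟨-, B, hB⟩ := bddMeas_obs (X := X) φ
  have hB0 : 0 ≤ |B| := abs_nonneg B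
  have hB' : ∀ x : Fin p → X, |φ (distVec x)| ≤ |B| := fun x => (hB x).trans (le_abs_self B)
  refine ⟨|B| * (p * Real.exp 1) ^ 2, fun r => ?_⟩
  rw [limitMoment, ← Finset.sum_filter]
  refine (Finset.abs_sum_le_sum_abs _ _).trans ?_
  refine (Finset.sum_le_card_nsmul _ _ (|B| ^ r) fun π _ => abs_partMoment_le hB' π).trans ?_
  rw [nsmul_eq_mul]
  have h1 : ((Finset.univ.filter fun π : SetPart r p =>
      π.parts.card = (p - 1) * r ∧ ¬ HomVanishing π).card : ℝ)
      ≤ (p * Real.exp 1) ^ (2 * r) * r.factorial :=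
    le_trans (by exact_mod_cast card_extremal_le r p) (choose_choose_le r p)
  calc _ ≤ ((p * Real.exp 1) ^ (2 * r) * r.factorial) * |B| ^ r := by gcongr
    _ = _ := by
      rw [mul_pow |B|, ← pow_mul]
      ring

variable {Ω : Type*} [MeasurableSpace Ω] {P : Measure Ω} [IsProbabilityMeasure P]
  {ξ : ℕ → Ω → X}

lemma tendsto_moment_sampleSum (hμ : IsHomogeneous μ) (hp : 1 ≤ p) {φ : C(Pairs p → ℝ, ℝ)}
    (hφ : polyObs φ μ = 0) (hmeas : ∀ i, Measurable (ξ i)) (hindep : iIndepFun ξ P)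
    (hlaw : ∀ i, P.map (ξ i) = μ) (r : ℕ) :
    Tendsto (fun n : ℕ => (∫ ω, sampleSum φ (fun i => ξ i ω) n ^ r ∂P) / (n : ℝ) ^ ((p - 1) * r))
      atTop (𝓝 (limitMoment μ φ r)) := by
  simp_rw [integral_sampleSum_pow hmeas hindep hlaw φ r]
  exact tendsto_sum_descFactorial _ fun π hπ => hπ.partMoment_eq_zero hμ hp hφ

lemma tendsto_jointCumulant_sampleSum (hμ : IsHomogeneous μ) (hp : 1 ≤ p) {φ : C(Pairs p → ℝ, ℝ)}
    (hφ : polyObs φ μ = 0) (hmeas : ∀ i, Measurable (ξ i)) (hindep : iIndepFun ξ P)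
    (hlaw : ∀ i, P.map (ξ i) = μ) (r : ℕ) :
    Tendsto (fun n : ℕ => jointCumulant P (fun (_ : Fin r) ω => sampleSum φ (fun i => ξ i ω) n)
        / (n : ℝ) ^ ((p - 1) * r)) atTop (𝓝 (kappaSum μ φ r)) := by
  simp_rw [jointCumulant_sampleSum hmeas hindep hlaw φ r]
  exact tendsto_sum_descFactorial _ fun π hπ => hπ.kappa_eq_zero hμ hp hφ

lemma cumulantOfMoments_scale (c : ℝ) (m : ℕ → ℝ) (r : ℕ) :
    cumulantOfMoments (fun k => m k / c ^ k) r = cumulantOfMoments m r / c ^ r := by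
  rw [cumulantOfMoments, cumulantOfMoments, Finset.sum_div]
  refine Finset.sum_congr rfl fun π _ => ?_
  rw [Finset.prod_div_distrib, Finset.prod_pow_eq_pow_sum, π.sum_card_parts, Finset.card_univ,
    Fintype.card_fin, mul_div_assoc]

/-- Both sides are limits of the cumulants of `S_n / n^(p-1)`, one through the moments and one
through the direct expansion. This avoids any combinatorial inversion over extremal partitions. -/
lemma cumulantOfMoments_limitMoment (hμ : IsHomogeneous μ) (hp : 1 ≤ p) {φ : C(Pairs p → ℝ, ℝ)}
    (hφ : polyObs φ μ = 0) (hmeas : ∀ i, Measurable (ξ i)) (hindep : iIndepFun ξ P)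
    (hlaw : ∀ i, P.map (ξ i) = μ) (r : ℕ) :
    cumulantOfMoments (limitMoment μ φ) r = kappaSum μ φ r := by
  have h1 := tendsto_cumulantOfMoments
    (tendsto_moment_sampleSum hμ hp hφ hmeas hindep hlaw) r
  refine tendsto_nhds_unique h1
    ((tendsto_jointCumulant_sampleSum hμ hp hφ hmeas hindep hlaw r).congr fun n => ?_)
  rw [jointCumulant_eq_cumulantOfMoments]
  simp_rw [pow_mul]
  rw [cumulantOfMoments_scale]

end LimitMoments

/-! ### The variance as a polynomial in `n⁻¹` -/

section Variance

open Polynomial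

variable {X : Type*} [MetricSpace X] [CompactSpace X] [MeasurableSpace X] [BorelSpace X]
  {μ : Measure X} [IsProbabilityMeasure μ] {p : ℕ}
  {Ω : Type*} [MeasurableSpace Ω] {P : Measure Ω} [IsProbabilityMeasure P] {ξ : ℕ → Ω → X}

/-- The coefficients are written with the centred observable so that those of vanishing partitions
are zero. -/
lemma variance_sampleSum (hmeas : ∀ i, Measurable (ξ i)) (hindep : iIndepFun ξ P)
    (hlaw : ∀ i, P.map (ξ i) = μ) (φ : C(Pairs p → ℝ, ℝ)) (n : ℕ) :
    variance (fun ω => sampleSum φ (fun i => ξ i ω) n) P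
      = ∑ π : SetPart 2 p, (n.descFactorial π.parts.card : ℝ) * kappa μ (centred μ φ) π := by
  rw [variance_eq_jointCumulant (bddMeas_sampleSum hmeas φ n),
    jointCumulant_sampleSum hmeas hindep hlaw]
  simp_rw [kappa_centred φ le_rfl]

lemma tendsto_variance_sampleSum (hμ : IsHomogeneous μ) (hp : 1 ≤ p)
    (hmeas : ∀ i, Measurable (ξ i)) (hindep : iIndepFun ξ P)
    (hlaw : ∀ i, P.map (ξ i) = μ) (φ : C(Pairs p → ℝ, ℝ)) :
    Tendsto (fun n : ℕ =>
        variance (fun ω => sampleSum φ (fun i => ξ i ω) n) P / (n : ℝ) ^ (2 * (p - 1)))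
      atTop (𝓝 (sigmaHomSq μ φ)) := by
  simp_rw [variance_sampleSum hmeas hindep hlaw φ]
  rw [← kappaSum_two_eq_sigmaHomSq, ← kappaSum_centred φ le_rfl, mul_comm 2]
  exact tendsto_sum_descFactorial _ fun π hπ => hπ.kappa_eq_zero hμ hp (polyObs_centred φ)

lemma variance_polyObs (φ : C(Pairs p → ℝ, ℝ)) {n : ℕ} (hn : 1 ≤ n) :
    variance (fun ω => polyObs φ (empMeasure (fun i => ξ i ω) n)) P
      = variance (fun ω => sampleSum φ (fun i => ξ i ω) n) P / (n : ℝ) ^ (2 * p) := by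
  simp_rw [polyObs_empMeasure φ _ hn, div_eq_inv_mul]
  rw [variance_const_mul, inv_pow, ← pow_mul, mul_comm p 2]

/-- The polynomial `∏_{i < l} (1 - i X)`, so that `n (n - 1) ⋯ (n - l + 1)` is `n ^ l` times its
value at `n⁻¹`. -/
def reverseDesc (l : ℕ) : ℝ[X] := ∏ i ∈ Finset.range l, (1 - C (i : ℝ) * Polynomial.X)

lemma descFactorial_eq_pow_mul_eval (l : ℕ) {n : ℕ} (hn : 1 ≤ n) :
    (n.descFactorial l : ℝ) = (n : ℝ) ^ l * (reverseDesc l).eval ((n : ℝ)⁻¹) := by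
  have hn0 : (n : ℝ) ≠ 0 := by
    have : (0 : ℝ) < n := by exact_mod_cast hn
    exact this.ne'
  rw [← descPochhammer_eval_eq_descFactorial, descPochhammer_eval_eq_prod_range, reverseDesc,
    eval_prod]
  have hpow : (n : ℝ) ^ l = ∏ _i ∈ Finset.range l, (n : ℝ) := by simp
  rw [hpow, ← Finset.prod_mul_distrib]
  refine Finset.prod_congr rfl fun i _ => ?_
  simp only [eval_sub, eval_one, eval_mul, eval_C, eval_X]
  field_simp

lemma reverseDesc_coeff_zero (l : ℕ) : (reverseDesc l).coeff 0 = 1 := by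
  rw [coeff_zero_eq_eval_zero, reverseDesc, eval_prod]
  simp

open Classical in
/-- The variance of `Φ(X_n)`, as a polynomial in `n⁻¹`. -/
def variancePoly (μ : Measure X) (φ : C(Pairs p → ℝ, ℝ)) : ℝ[X] :=
  ∑ π : SetPart 2 p with ¬ HomVanishing π,
    C (kappa μ φ π) * (Polynomial.X ^ (2 * p - π.parts.card) * reverseDesc π.parts.card)

lemma two_le_sub_card_parts (hp : 1 ≤ p) {π : SetPart 2 p} (h : ¬ HomVanishing π) :
    2 ≤ 2 * p - π.parts.card := by
  have := card_parts_le_of_not_homVanishing h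
  omega

lemma variancePoly_coeff_of_lt_two (hp : 1 ≤ p) (φ : C(Pairs p → ℝ, ℝ)) {i : ℕ} (hi : i < 2) :
    (variancePoly μ φ).coeff i = 0 := by
  classical
  rw [variancePoly, finsetSum_coeff]
  refine Finset.sum_eq_zero fun π hπ => ?_
  have := two_le_sub_card_parts hp (Finset.mem_filter.1 hπ).2
  rw [coeff_C_mul, coeff_X_pow_mul', if_neg (by omega), mul_zero]

lemma variancePoly_coeff_two (hp : 1 ≤ p) (φ : C(Pairs p → ℝ, ℝ)) :
    (variancePoly μ φ).coeff 2 = kappaSum μ φ 2 := by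
  classical
  rw [variancePoly, finsetSum_coeff, kappaSum, Finset.sum_filter]
  refine Finset.sum_congr rfl fun π _ => ?_
  by_cases hπ : HomVanishing π
  · simp [hπ]
  have h1 := two_le_sub_card_parts hp hπ
  have h2 := card_parts_le_of_not_homVanishing hπ
  simp only [hπ, not_false_eq_true, if_true, and_true]
  rw [coeff_C_mul, coeff_X_pow_mul']
  by_cases hc : π.parts.card = (p - 1) * 2
  · rw [if_pos (by omega), if_pos hc, show 2 - (2 * p - π.parts.card) = 0 by omega,
      reverseDesc_coeff_zero, mul_one]
  · rw [if_neg (by omega), if_neg hc, mul_zero]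

/-- A partition with `ℓ` parts contributes `n^(ℓ-2p)` times a polynomial in `n⁻¹` with constant term
`1`; since `ℓ ≤ 2p - 2`, the expansion starts at `n⁻²`. -/
lemma variance_polyObs_eq_eval (hμ : IsHomogeneous μ) (hp : 1 ≤ p)
    (hmeas : ∀ i, Measurable (ξ i)) (hindep : iIndepFun ξ P)
    (hlaw : ∀ i, P.map (ξ i) = μ) (φ : C(Pairs p → ℝ, ℝ)) {n : ℕ} (hn : 1 ≤ n) :
    variance (fun ω => polyObs φ (empMeasure (fun i => ξ i ω) n)) P
      = (variancePoly μ (centred μ φ)).eval ((n : ℝ)⁻¹) := by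
  classical
  have hn0 : (n : ℝ) ≠ 0 := by
    have : (0 : ℝ) < n := by exact_mod_cast hn
    exact this.ne'
  rw [variance_polyObs φ hn, variance_sampleSum hmeas hindep hlaw, Finset.sum_div, variancePoly,
    eval_finsetSum, Finset.sum_filter]
  refine Finset.sum_congr rfl fun π _ => ?_
  by_cases hπ : HomVanishing π
  · simp [hπ, hπ.kappa_eq_zero hμ hp (polyObs_centred φ)]
  rw [if_pos hπ, descFactorial_eq_pow_mul_eval _ hn, eval_mul, eval_mul, eval_C, eval_pow, eval_X]
  have h2 := card_parts_le_of_not_homVanishing hπ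
  have hpow : (n : ℝ) ^ (2 * p) = (n : ℝ) ^ π.parts.card * (n : ℝ) ^ (2 * p - π.parts.card) := by
    rw [← pow_add]
    congr 1
    omega
  rw [hpow, inv_pow]
  field_simp

/-- `n` times the standard deviation of `Φ(X_n)` converges. -/
lemma tendsto_mul_sqrt_variance_polyObs (hμ : IsHomogeneous μ) (hp : 1 ≤ p)
    (hmeas : ∀ i, Measurable (ξ i)) (hindep : iIndepFun ξ P)
    (hlaw : ∀ i, P.map (ξ i) = μ) (φ : C(Pairs p → ℝ, ℝ)) :
    Tendsto (fun n : ℕ => (n : ℝ) *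
        √(variance (fun ω => polyObs φ (empMeasure (fun i => ξ i ω) n)) P))
      atTop (𝓝 √(sigmaHomSq μ φ)) := by
  refine (tendsto_variance_sampleSum hμ hp hmeas hindep hlaw φ).sqrt.congr' ?_
  filter_upwards [eventually_ge_atTop 1] with n hn
  have hn0 : (0 : ℝ) < n := by exact_mod_cast hn
  rw [variance_polyObs φ hn, show 2 * p = 2 * (p - 1) + 2 by omega, pow_add, ← div_div,
    Real.sqrt_div' _ (sq_nonneg (n : ℝ)), Real.sqrt_sq hn0.le]
  field_simp

end Variance

/-! ### Moments of the normalised fluctuations -/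

section Fluctuations

variable {X : Type*} [MetricSpace X] [CompactSpace X] [MeasurableSpace X] [BorelSpace X]
  {μ : Measure X} [IsProbabilityMeasure μ] {p : ℕ}
  {Ω : Type*} [MeasurableSpace Ω] {P : Measure Ω} [IsProbabilityMeasure P] {ξ : ℕ → Ω → X}

/-- The factor `n^p` is split as `n^(p-1) · n`, so that the moments of the numerator and the
denominator converge separately. -/
lemma fluct_eq (hp : 1 ≤ p) (φ : C(Pairs p → ℝ, ℝ)) {n : ℕ} (hn : 1 ≤ n) (ω : Ω) :
    fluct μ φ P ξ n ω = sampleSum (centred μ φ) (fun i => ξ i ω) n / (n : ℝ) ^ (p - 1) /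
      ((n : ℝ) * √(variance (fun ω' => polyObs φ (empMeasure (fun i => ξ i ω') n)) P)) := by
  have hn0 : (n : ℝ) ≠ 0 := by
    have : (0 : ℝ) < n := by exact_mod_cast hn
    exact this.ne'
  rw [fluct, polyObs_empMeasure φ _ hn, sampleSum_centred, ← div_div]
  congr 1
  obtain ⟨q, rfl⟩ : ∃ q, p = q + 1 := ⟨p - 1, by omega⟩
  rw [Nat.add_sub_cancel]
  field_simp
  ring

lemma bddMeas_fluct (hmeas : ∀ i, Measurable (ξ i)) (φ : C(Pairs p → ℝ, ℝ)) (n : ℕ) :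
    BddMeas (fluct μ φ P ξ n) := by
  have h : BddMeas fun ω => polyObs φ (empMeasure (fun i => ξ i ω) n) := by
    -- At `n = 0` the empirical measure is the zero measure, so the observable is constant in `ω`.
    rcases Nat.eq_zero_or_pos n with rfl | hn
    · simp only [empMeasure, Finset.range_zero, Finset.sum_empty, smul_zero]
      exact bddMeas_const _
    · simp_rw [polyObs_empMeasure φ _ hn, div_eq_mul_inv]
      exact (bddMeas_sampleSum hmeas φ n).mul (bddMeas_const _)
  have h2 := (h.add (bddMeas_const (-polyObs φ μ))).mul (bddMeas_const
    (√(variance (fun ω' => polyObs φ (empMeasure (fun i => ξ i ω') n)) P))⁻¹)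
  exact h2

lemma tendsto_moment_fluct (hμ : IsHomogeneous μ) (hp : 1 ≤ p)
    (hmeas : ∀ i, Measurable (ξ i)) (hindep : iIndepFun ξ P)
    (hlaw : ∀ i, P.map (ξ i) = μ) (φ : C(Pairs p → ℝ, ℝ)) (hσ : 0 < sigmaHomSq μ φ) (k : ℕ) :
    Tendsto (fun n => ∫ ω, fluct μ φ P ξ n ω ^ k ∂P) atTop
      (𝓝 (limitMoment μ (centred μ φ) k / √(sigmaHomSq μ φ) ^ k)) := by
  have h1 := tendsto_moment_sampleSum hμ hp (polyObs_centred φ) hmeas hindep hlaw k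
  have h2 := (tendsto_mul_sqrt_variance_polyObs hμ hp hmeas hindep hlaw φ).pow k
  have hσ' : √(sigmaHomSq μ φ) ^ k ≠ 0 := pow_ne_zero _ (Real.sqrt_pos.2 hσ).ne'
  refine (h1.div h2 hσ').congr' ?_
  filter_upwards [eventually_ge_atTop 1] with n hn
  simp_rw [fluct_eq hp φ hn, div_pow, ← pow_mul]
  rw [integral_div, integral_div]
  rfl

end Fluctuations

end MMSpace

end

open MMSpace in
theorem mainTheorem3 {X : Type*} [MetricSpace X] [MeasurableSpace X] [BorelSpace X]
    (μ : Measure X) [IsProbabilityMeasure μ] (hX : MMSpace.IsCompactHomogeneous X μ)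
    {p : ℕ} (hp : 1 ≤ p) (φ : C(MMSpace.Pairs p → ℝ, ℝ))
    {Ω : Type*} [MeasurableSpace Ω] (P : Measure Ω) [IsProbabilityMeasure P]
    (ξ : ℕ → Ω → X) (hmeas : ∀ i, Measurable (ξ i)) (hindep : iIndepFun ξ P)
    (hlaw : ∀ i, P.map (ξ i) = μ) :
    -- `σ²_hom` is the limit of `var(S_n) / n^{2(p-1)}`
    Tendsto (fun n : ℕ =>
        variance (fun ω => MMSpace.sampleSum φ (fun i => ξ i ω) n) P / (n : ℝ) ^ (2 * (p - 1)))
      atTop (𝓝 (MMSpace.sigmaHomSq μ φ)) ∧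
    (0 < MMSpace.sigmaHomSq μ φ →
      -- convergence in distribution to a random variable `Y` with law `ν`
      (∃ (ν : Measure ℝ) (_ : IsProbabilityMeasure ν),
        TendstoInDistribution (MMSpace.fluct μ φ P ξ) atTop (id : ℝ → ℝ) (fun _ => P) ν ∧
        -- the moment generating function of `Y` converges near `0`
        0 ∈ interior (integrableExpSet (id : ℝ → ℝ) ν) ∧
        -- the cumulants of `Y`
        MMSpace.cumulant ν 1 =
          (MMSpace.kappaSum μ φ 1 - (p.choose 2 : ℝ) * MMSpace.polyObs φ μ) /
            √(MMSpace.sigmaHomSq μ φ) ∧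
        (∀ r : ℕ, 2 ≤ r →
          MMSpace.cumulant ν r = MMSpace.kappaSum μ φ r / √(MMSpace.sigmaHomSq μ φ) ^ r) ∧
        -- the law of `Y` is determined by its cumulants, and by its moments
        (∀ ν' : Measure ℝ, IsProbabilityMeasure ν' →
          (∀ k : ℕ, Integrable (fun x : ℝ => x ^ k) ν') →
          (∀ r : ℕ, 1 ≤ r → MMSpace.cumulant ν' r = MMSpace.cumulant ν r) → ν' = ν) ∧
        (∀ ν' : Measure ℝ, IsProbabilityMeasure ν' →
          (∀ k : ℕ, Integrable (fun x : ℝ => x ^ k) ν') →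
          (∀ k : ℕ, ∫ x, x ^ k ∂ν' = ∫ x, x ^ k ∂ν) → ν' = ν)) ∧
      -- `√var(Φ(X_n))` is of order `n⁻¹`
      (fun n : ℕ => √(variance
          (fun ω => MMSpace.polyObs φ (MMSpace.empMeasure (fun i => ξ i ω) n)) P))
        =Θ[atTop] (fun n : ℕ => ((n : ℝ))⁻¹) ∧
      -- `var(Φ(X_n))` is a polynomial in `n⁻¹` with lowest order term `σ²_hom n⁻²`
      (∃ Q : Polynomial ℝ, Q.coeff 0 = 0 ∧ Q.coeff 1 = 0 ∧ Q.coeff 2 = MMSpace.sigmaHomSq μ φ ∧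
        ∀ n : ℕ, 1 ≤ n →
          variance (fun ω => MMSpace.polyObs φ (MMSpace.empMeasure (fun i => ξ i ω) n)) P
            = Q.eval ((n : ℝ)⁻¹))) := by
  have hcomp := hX.compactSpace
  have hμ := hX.isHomogeneous
  refine ⟨tendsto_variance_sampleSum hμ hp hmeas hindep hlaw φ, fun hσ => ⟨?_, ?_, ?_⟩⟩
  · have hbdd := bddMeas_fluct (μ := μ) (P := P) hmeas φ
    have hm := tendsto_moment_fluct hμ hp hmeas hindep hlaw φ hσ
    obtain ⟨D, hD⟩ := exists_abs_limitMoment_le μ (centred μ φ)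
    set σ := √(sigmaHomSq μ φ) with hσdef
    have hσ0 : 0 < σ := Real.sqrt_pos.2 hσ
    let law : ℕ → ProbabilityMeasure ℝ := fun n =>
      ⟨P.map (fluct μ φ P ξ n), Measure.isProbabilityMeasure_map (hbdd n).1.aemeasurable⟩
    have hmom : ∀ n (k : ℕ), ∫ x, x ^ k ∂(law n : Measure ℝ) = ∫ ω, fluct μ φ P ξ n ω ^ k ∂P :=
      fun n k => integral_map (hbdd n).1.aemeasurable (by fun_prop)
    have hinteg : ∀ n (k : ℕ), Integrable (fun x : ℝ => x ^ k) (law n : Measure ℝ) := fun n k =>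
      (integrable_map_measure (by fun_prop) (hbdd n).1.aemeasurable).2
        (((hbdd n).pow k).integrable P)
    -- Dividing the bound `D^k k!` by `σ^k` gives the constants `A = 1` and `C = D / σ`.
    obtain ⟨ν, hlim, hexp, hνm, huniq⟩ := exists_tendsto_of_moments_tendsto hinteg
      (m := fun k => limitMoment μ (centred μ φ) k / σ ^ k) (A := 1) (C := D / σ)
      (fun k => by simp_rw [hmom]; exact hm k) (fun k => by
        rw [abs_div, abs_of_pos (pow_pos hσ0 k), div_le_iff₀ (pow_pos hσ0 k), div_pow]
        refine (hD k).trans_eq ?_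
        field_simp)
    have hcum : ∀ r, cumulant (ν : Measure ℝ) r = kappaSum μ (centred μ φ) r / σ ^ r := by
      intro r
      rw [cumulant_eq_cumulantOfMoments, funext hνm, cumulantOfMoments_scale,
        cumulantOfMoments_limitMoment hμ hp (polyObs_centred φ) hmeas hindep hlaw]
    refine ⟨ν, inferInstance, ⟨fun n => (hbdd n).1.aemeasurable, aemeasurable_id, ?_⟩, hexp,
      ?_, ?_, ?_, ?_⟩
    · convert! hlim
      exact congrArg 𝓝 (Subtype.ext Measure.map_id)
    · rw [hcum, kappaSum_centred_one hp, pow_one]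
    · intro r hr
      rw [hcum, kappaSum_centred φ hr]
    · intro ν' hν' hi hc
      refine huniq ν' hν' hi fun k => ?_
      rw [← hνm k]
      -- Equal cumulants give equal moments, which reduces uniqueness to the moment problem.
      refine moments_eq_of_cumulants_eq (m := fun k => ∫ x, x ^ k ∂ν')
        (m' := fun k => ∫ x, x ^ k ∂(ν : Measure ℝ)) (by simp) (fun r hr => ?_) k
      rw [← cumulant_eq_cumulantOfMoments, ← cumulant_eq_cumulantOfMoments]
      exact hc r hr
    · intro ν' hν' hi hc
      exact huniq ν' hν' hi fun k => (hc k).trans (hνm k)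
  · have h := tendsto_mul_sqrt_variance_polyObs hμ hp hmeas hindep hlaw φ
    refine (isTheta_of_div_tendsto_nhds_ne_zero (h.congr fun n => ?_) (Real.sqrt_pos.2 hσ).ne').symm
    rw [div_inv_eq_mul, mul_comm]
  · exact ⟨variancePoly μ (centred μ φ), variancePoly_coeff_of_lt_two hp _ (by norm_num),
      variancePoly_coeff_of_lt_two hp _ (by norm_num), by
        rw [variancePoly_coeff_two hp, kappaSum_centred φ le_rfl, kappaSum_two_eq_sigmaHomSq],
      fun n hn => variance_polyObs_eq_eval hμ hp hmeas hindep hlaw φ hn⟩
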